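/- Conventions. Let $U$ be a universal prefix-free machine (a partial computable function on finite binary strings with prefix-free domain which simulates every other such function with programs longer by at most an additive constant), let $\mathrm K(\sigma)=\min\{|\tau| : U(\tau)=\sigma\}$, let $\Omega=\sum_{U(\sigma)\downarrow}2^{-|\sigma|}$, identified with the infinite sequence of its binary digits, and let $\langle\cdot,\cdot\rangle$ be a computable bijection from pairs of strings to strings. For strings put $\mathbf I(\sigma:\tau)=\mathrm K(\sigma)+\mathrm K(\tau)-\mathrm K(\langle\sigma,\tau\rangle)$. A discrete semi-measure is a function $m\ge 0$ on strings with $\sum_\sigma m(\sigma)\le 1$. Let $\mathbf m$ be a universal lower semi-computable discrete semi-measure (one that dominates each such semi-measure up to a multiplicative constant), and for $X\in 2^{\mathbb N}$ let $\mathbf m^X$ be a universal discrete semi-measure among those lower semi-computable relative to the oracle $X$. For sequences $X,Y$, the quantity $\mathbf I(X:Y)\in[-\infty,\infty]$ is defined by $2^{\mathbf I(X:Y)}=\sum_{\sigma,\tau}\mathbf m^X(\sigma)\,\mathbf m^Y(\tau)\,2^{\mathbf I(\sigma:\tau)}$. Write $X{\upharpoonright}n$ for the string of the first $n$ bits of $X$.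 Theorem. Let $\mathcal C\subseteq 2^{\mathbb N}$ be a $\Pi^0_1$ class, let $T$ be the set of all prefixes of members of $\mathcal C$ (its canonical co-c.e. tree), and let $T_k$ be the set of strings of length $k$ in $T$. Suppose that $\mathcal C$ is deep, witnessed by a computable, non-decreasing and unbounded function $f:\mathbb N\to\mathbb N$ such that $\mathbf m(T_{f(n)})=\sum_{\sigma\in T_{f(n)}}\mathbf m(\sigma)<2^{-n}$ for all $n$. Then there is a constant $c$ such that for every $Y\in\mathcal C$ and all $n$, $$\mathbf I\big(\Omega{\upharpoonright}n : Y{\upharpoonright}f(n)\big)\ \ge\ n-c\log_2(n+2).$$ In particular, $\mathbf I(\Omega:Y)=\infty$ for every $Y\in\mathcal C$. -/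

import Mathlib

open scoped ENNReal NNReal Topology

noncomputable section

namespace AlgInfo

/-! ### Cantor space, trees and effectively closed classes -/

/-- `X ↾ n`: the string of the first `n` bits of the sequence `X`. -/
def restrict (X : ℕ → Bool) (n : ℕ) : List Bool :=
  (List.range n).map X

/-- `σ ≺ X`: the string `σ` is a prefix of the sequence `X`. -/
def IsInitial (σ : List Bool) (X : ℕ → Bool) : Prop :=
  restrict X σ.length = σ

/-- A `Π⁰₁` class: the complement of the union of the cylinders of a c.e. set of strings. -/
def IsPi01 (C : Set (ℕ → Bool)) : Prop :=
  ∃ S : List Bool → Prop, REPred S ∧ Cᶜ = {X | ∃ σ, S σ ∧ IsInitial σ X}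

/-- The canonical co-c.e. tree of a class: the set of all prefixes of its members. -/
def canonicalTree (C : Set (ℕ → Bool)) : Set (List Bool) :=
  {σ | ∃ X ∈ C, IsInitial σ X}

/-- `T_n`: the set of the members of `T` of length `n`. -/
def level (T : Set (List Bool)) (n : ℕ) : Set (List Bool) :=
  {σ | σ ∈ T ∧ σ.length = n}

/-- Order functions: non-decreasing and unbounded. -/
def IsOrder (f : ℕ → ℕ) : Prop :=
  Monotone f ∧ ∀ k, ∃ n, k ≤ f n

/-! ### Lower semi-computable discrete semi-measures, relative to oracles

The set `O` is a set of oracles; `O = ∅` gives the unrelativized notions, see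
`computableIn_empty_iff`. -/

theorem computableIn_empty_iff {α σ : Type*} [Primcodable α] [Primcodable σ] {f : α → σ} :
    ComputableIn ∅ f ↔ Computable f :=
  ⟨fun h => Nat.RecursiveIn.partrec_of_oracle (by simp) h, Computable.computableIn⟩

/-- The oracle given by a sequence. -/
def oracle (X : ℕ → Bool) : Set (ℕ →. ℕ) :=
  {fun n => Part.some (X n).toNat}

/-- The non-negative dyadic rational `a / 2 ^ k` coded by the pair `(a, k)`. -/
def dyadic (q : ℕ × ℕ) : ℝ≥0∞ :=
  (q.1 : ℝ≥0∞) / 2 ^ q.2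

/-- `m` is the limit of a non-decreasing `O`-computable sequence of dyadic-valued functions. -/
def LowerSemicomputableIn (O : Set (ℕ →. ℕ)) (m : List Bool → ℝ≥0∞) : Prop :=
  ∃ a : List Bool → ℕ → ℕ × ℕ, ComputableIn₂ O a ∧
    ∀ σ, Monotone (fun i => dyadic (a σ i)) ∧
      Filter.Tendsto (fun i => dyadic (a σ i)) Filter.atTop (𝓝 (m σ))

/-- An `O`-lower semi-computable discrete semi-measure. -/
def IsSemimeasureIn (O : Set (ℕ →. ℕ)) (m : List Bool → ℝ≥0∞) : Prop :=
  ∑' σ, m σ ≤ 1 ∧ LowerSemicomputableIn O m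

/-- A universal `O`-lower semi-computable discrete semi-measure. -/
def IsUniversalSemimeasureIn (O : Set (ℕ →. ℕ)) (m : List Bool → ℝ≥0∞) : Prop :=
  IsSemimeasureIn O m ∧
    ∀ m', IsSemimeasureIn O m' → ∃ c : ℝ≥0, ∀ σ, m' σ ≤ c * m σ

/-- `m(S) = ∑_{σ ∈ S} m(σ)`. -/
def weight (m : List Bool → ℝ≥0∞) (S : Set (List Bool)) : ℝ≥0∞ :=
  ∑' σ : S, m σ

/-! ### Prefix-free machines and Kolmogorov complexity -/

/-- A prefix-free machine: a partial computable function on strings with prefix-free domain. -/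
def IsPrefixFreeMachine (U : List Bool →. List Bool) : Prop :=
  Partrec U ∧ ∀ σ τ, (U σ).Dom → (U τ).Dom → σ <+: τ → σ = τ

/-- A universal prefix-free machine: it simulates every prefix-free machine with programs longer
by at most an additive constant. Machines `U` such that every prefix-free `M` has a coding string
`ρ` with `U (ρ ++ τ) = M τ` for all `τ` are a special case. -/
def IsUniversalMachine (U : List Bool →. List Bool) : Prop :=
  IsPrefixFreeMachine U ∧
    ∀ M, IsPrefixFreeMachine M →
      ∃ c : ℕ, ∀ τ σ, σ ∈ M τ → ∃ τ', σ ∈ U τ' ∧ τ'.length ≤ τ.length + c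

/-- Prefix-free Kolmogorov complexity (the minimum exists if `U` is universal). -/
def K (U : List Bool →. List Bool) (σ : List Bool) : ℕ :=
  sInf {n | ∃ τ : List Bool, τ.length = n ∧ σ ∈ U τ}

/-- The halting probability of the machine `U`. -/
def omegaReal (U : List Bool →. List Bool) : ℝ :=
  ∑' σ : {σ : List Bool // (U σ).Dom}, (2 : ℝ)⁻¹ ^ σ.1.length

/-- Chaitin's `Ω` as a sequence: the binary expansion of the halting probability. -/
def omega (U : List Bool →. List Bool) (n : ℕ) : Bool :=
  decide (Real.digits (omegaReal U) 2 n = 1)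

/-! ### Mutual information -/

/-- `I(σ : τ) = K(σ) + K(τ) - K(σ, τ)`, where `K(σ, τ)` is the complexity of the string that codes
the pair. -/
def mutualInfo (U : List Bool →. List Bool) (pair : List Bool × List Bool ≃ List Bool)
    (σ τ : List Bool) : ℤ :=
  (K U σ : ℤ) + K U τ - K U (pair (σ, τ))

/-- Mutual information of two sequences `X` and `Y`, where `mX` and `mY` are the universal
semi-measures relative to `X` and `Y`: the binary logarithm of
`∑_{σ, τ} mX(σ) * mY(τ) * 2 ^ I(σ : τ)`. -/
def mutualInfoSeq (U : List Bool →. List Bool) (pair : List Bool × List Bool ≃ List Bool)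
    (mX mY : List Bool → ℝ≥0∞) : EReal :=
  ENNReal.log (∑' p : List Bool × List Bool,
    mX p.1 * mY p.2 * (2 : ℝ≥0∞) ^ mutualInfo U pair p.1 p.2) / (Real.log 2 : ℝ)

end AlgInfo

end

open scoped ENNReal NNReal Topology

noncomputable section

namespace AlgInfo

/-! The plan is to give (Ω↾n, Y↾f(n)) a joint description about n bits shorter than separate
descriptions of its components. In fact I(Ω↾n : Y↾f(n)) ≥ n − O(1), which is stronger than the
claim.

Enumerate the programs of U, let Ω_u be the weight of those enumerated before stage u, and
approximate T from outside. Given σ of length n, wait for the first stage u at which Ω_u + 2^{-n} ≥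
0.σ and the programs enumerated so far with outputs in the current approximation of T_{f(n)} have
weight at most 2^b·2^{-n}. From then on serve programs for these strings only until the total weight
passes Ω_u + 2·2^{-n}. The served programs have weight at most (2^b + 2)·2^{-n} ≤ 2^{b+2}·2^{-n}, so
for programs p of σ and q of τ a description of (σ, τ) of length |p| + |q| + b + 2 − n can be
requested: the requests for fixed p weigh at most 2^{-|p|} (`tsum_request_le`), all of them at most
Ω ≤ 1, and Kraft–Chaitin applies (`exists_machine_of_requests`, `exists_K_bound`).

If σ = Ω↾n, a suitable u exists: by compactness the approximation reaches T_{f(n)}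
(`eventually_covered_level`), and depth with the universality of m makes the weight small
(`IsEnumeration.exists_tsum_selWeight_le`). Moreover Ω ≤ 0.σ + 2^{-n} ≤ Ω_u + 2·2^{-n}, so no
program for a string of T_{f(n)} is left out (`exists_le_mutualInfo`).

For I(Ω : Y) = ∞, the relative semi-measures give Ω↾n and Y↾f(n) weight of order 2^{-j} along n = 4j
+ const, while the information factor is at least 2^{4j+4}; single terms of the sum are unbounded
(`mutualInfoSeq_eq_top`). -/

/-! ### Binary values of strings -/

/-- The natural number with binary expansion `l` (most significant bit first). -/
def binVal (l : List Bool) : ℕ :=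
  l.foldl (fun a b => 2 * a + b.toNat) 0

theorem foldl_binVal (l : List Bool) (a : ℕ) :
    l.foldl (fun a b => 2 * a + b.toNat) a = a * 2 ^ l.length + binVal l := by
  induction l generalizing a with
  | nil => simp [binVal]
  | cons b l ih =>
    simp only [List.foldl_cons, List.length_cons, binVal]
    rw [ih, ih (2 * 0 + b.toNat)]
    ring

theorem binVal_append (l l' : List Bool) :
    binVal (l ++ l') = binVal l * 2 ^ l'.length + binVal l' := by
  rw [binVal, List.foldl_append, foldl_binVal]
  rfl

theorem binVal_concat (l : List Bool) (b : Bool) : binVal (l ++ [b]) = 2 * binVal l + b.toNat := by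
  simp [binVal]

theorem binVal_lt (l : List Bool) : binVal l < 2 ^ l.length := by
  induction l using List.reverseRecOn with
  | nil => simp [binVal]
  | append_singleton l b ih =>
    rw [binVal_concat, List.length_append, List.length_singleton, pow_succ]
    have := Bool.toNat_le b
    omega

theorem exists_binVal_eq (n j : ℕ) (h : j < 2 ^ n) :
    ∃ l : List Bool, l.length = n ∧ binVal l = j := by
  induction n generalizing j with
  | zero => exact ⟨[], rfl, by simp at h; simp [h, binVal]⟩
  | succ n ih =>
    obtain ⟨l, hl, hj⟩ := ih (j / 2) (by rw [pow_succ] at h; omega)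
    refine ⟨l ++ [decide (j % 2 = 1)], by simp [hl], ?_⟩
    rw [binVal_concat, hj]
    rcases Nat.mod_two_eq_zero_or_one j with h | h <;> simp [h] <;> omega

theorem primrec_binVal : Primrec binVal :=
  Primrec.list_foldl (h := fun _ (p : ℕ × Bool) => 2 * p.1 + p.2.toNat) Primrec.id (Primrec.const 0)
    (Primrec.nat_add.comp (Primrec.nat_double.comp (Primrec.fst.comp Primrec.snd))
      ((Primrec.dom_bool Bool.toNat).comp (Primrec.snd.comp Primrec.snd))).to₂

/-! ### Arithmetic of dyadic rationals -/

theorem primrec_two_pow : Primrec fun n : ℕ => 2 ^ n :=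
  (Primrec₂.unpaired'.1 Nat.Primrec.pow).comp (Primrec.const 2) Primrec.id

/-- The sum of two coded dyadic rationals. -/
def dyAdd (p q : ℕ × ℕ) : ℕ × ℕ :=
  (p.1 * 2 ^ q.2 + q.1 * 2 ^ p.2, p.2 + q.2)

theorem dyadic_eq_ofReal (p : ℕ × ℕ) : dyadic p = ENNReal.ofReal ((p.1 : ℝ) / 2 ^ p.2) := by
  rw [dyadic, ENNReal.ofReal_div_of_pos (by positivity), ENNReal.ofReal_natCast,
    ENNReal.ofReal_pow (by norm_num)]
  simp

theorem dyadic_ne_top (p : ℕ × ℕ) : dyadic p ≠ ∞ := by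
  rw [dyadic_eq_ofReal]; exact ENNReal.ofReal_ne_top

theorem dyadic_dyAdd (p q : ℕ × ℕ) : dyadic (dyAdd p q) = dyadic p + dyadic q := by
  simp only [dyadic_eq_ofReal]
  rw [← ENNReal.ofReal_add (by positivity) (by positivity)]
  congr 1
  simp only [dyAdd]
  push_cast
  rw [pow_add]
  field_simp

theorem dyadic_zero : dyadic (0, 0) = 0 := by simp [dyadic]

theorem dyadic_one (n : ℕ) : dyadic (1, n) = 2⁻¹ ^ n := by
  simp [dyadic, ENNReal.inv_pow]

/-- The order of coded dyadic rationals. -/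
def DyLe (p q : ℕ × ℕ) : Prop :=
  p.1 * 2 ^ q.2 ≤ q.1 * 2 ^ p.2

theorem dyLe_iff (p q : ℕ × ℕ) : DyLe p q ↔ dyadic p ≤ dyadic q := by
  simp only [dyadic_eq_ofReal]
  rw [ENNReal.ofReal_le_ofReal_iff (by positivity), div_le_div_iff₀ (by positivity) (by positivity),
    DyLe]
  exact_mod_cast Iff.rfl

theorem two_inv_pow_le_iff (a b : ℕ) : (2 : ℝ≥0∞)⁻¹ ^ a ≤ 2⁻¹ ^ b ↔ b ≤ a := by
  rw [← dyadic_one, ← dyadic_one, ← dyLe_iff, DyLe, one_mul, one_mul,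
    Nat.pow_le_pow_iff_right (by norm_num)]

theorem primrec_dyAdd : Primrec₂ dyAdd := by
  have p1 : Primrec fun x : (ℕ × ℕ) × (ℕ × ℕ) => x.1.1 := Primrec.fst.comp Primrec.fst
  have p2 : Primrec fun x : (ℕ × ℕ) × (ℕ × ℕ) => x.1.2 := Primrec.snd.comp Primrec.fst
  have q1 : Primrec fun x : (ℕ × ℕ) × (ℕ × ℕ) => x.2.1 := Primrec.fst.comp Primrec.snd
  have q2 : Primrec fun x : (ℕ × ℕ) × (ℕ × ℕ) => x.2.2 := Primrec.snd.comp Primrec.snd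
  exact Primrec.pair (Primrec.nat_add.comp (Primrec.nat_mul.comp p1 (primrec_two_pow.comp q2))
    (Primrec.nat_mul.comp q1 (primrec_two_pow.comp p2))) (Primrec.nat_add.comp p2 q2)

theorem primrec_dyLe : PrimrecRel DyLe := by
  have p1 : Primrec fun x : (ℕ × ℕ) × (ℕ × ℕ) => x.1.1 := Primrec.fst.comp Primrec.fst
  have p2 : Primrec fun x : (ℕ × ℕ) × (ℕ × ℕ) => x.1.2 := Primrec.snd.comp Primrec.fst
  have q1 : Primrec fun x : (ℕ × ℕ) × (ℕ × ℕ) => x.2.1 := Primrec.fst.comp Primrec.snd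
  have q2 : Primrec fun x : (ℕ × ℕ) × (ℕ × ℕ) => x.2.2 := Primrec.snd.comp Primrec.snd
  exact Primrec.nat_le.comp (Primrec.nat_mul.comp p1 (primrec_two_pow.comp q2))
    (Primrec.nat_mul.comp q1 (primrec_two_pow.comp p2))

instance : DecidableRel DyLe := fun _ _ => inferInstanceAs (Decidable (_ ≤ _))

/-- Partial sums of a sequence of coded dyadic rationals. -/
def dySum (w : ℕ → ℕ × ℕ) (n : ℕ) : ℕ × ℕ :=
  Nat.rec (0, 0) (fun i s => dyAdd s (w i)) n

theorem dyadic_dySum (w : ℕ → ℕ × ℕ) (n : ℕ) :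
    dyadic (dySum w n) = ∑ i ∈ Finset.range n, dyadic (w i) := by
  induction n with
  | zero => exact dyadic_zero
  | succ n ih => rw [Finset.sum_range_succ, ← ih, ← dyadic_dyAdd]; rfl

theorem monotone_dyadic_dySum (w : ℕ → ℕ × ℕ) : Monotone fun n => dyadic (dySum w n) := by
  intro a b h
  simp only [dyadic_dySum]
  exact Finset.sum_le_sum_of_subset (Finset.range_mono h)

theorem tendsto_dyadic_dySum (w : ℕ → ℕ × ℕ) :
    Filter.Tendsto (fun n => dyadic (dySum w n)) Filter.atTop (𝓝 (∑' i, dyadic (w i))) := by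
  simp only [dyadic_dySum]
  exact ENNReal.tendsto_nat_tsum _

theorem dyadic_dySum_le_tsum (w : ℕ → ℕ × ℕ) (n : ℕ) :
    dyadic (dySum w n) ≤ ∑' i, dyadic (w i) := by
  rw [dyadic_dySum]; exact ENNReal.sum_le_tsum _

theorem primrec_dySum {α : Type*} [Primcodable α] {w : α → ℕ → ℕ × ℕ} (hw : Primrec₂ w) :
    Primrec₂ fun a n => dySum (w a) n :=
  Primrec.nat_rec (Primrec.const (0, 0))
    (primrec_dyAdd.comp (Primrec.snd.comp Primrec.snd)
      (hw.comp Primrec.fst (Primrec.fst.comp Primrec.snd))).to₂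

theorem computable_dySum {α : Type*} [Primcodable α] {w : α → ℕ → ℕ × ℕ} (hw : Computable₂ w)
    {g : α → ℕ} (hg : Computable g) : Computable fun a => dySum (w a) (g a) :=
  Computable.nat_rec hg (Computable.const (0, 0))
    (primrec_dyAdd.to_comp.comp (Computable.snd.comp Computable.snd)
      (hw.comp Computable.fst (Computable.fst.comp Computable.snd))).to₂

/-! ### Kraft's inequality for prefix-free sets -/

/-- A prefix-free set without the empty string is uniquely decodable, so the Kraft–McMillan
inequality applies; a prefix-free set with the empty string has no other member. -/
theorem sum_le_one_of_prefixFree (s : Finset (List Bool))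
    (h : ∀ σ ∈ s, ∀ τ ∈ s, σ <+: τ → σ = τ) : ∑ σ ∈ s, (2 : ℝ)⁻¹ ^ σ.length ≤ 1 := by
  by_cases h0 : [] ∈ s
  · have : s = {[]} := by
      ext τ
      simp only [Finset.mem_singleton]
      exact ⟨fun ht => (h _ h0 _ ht List.nil_prefix).symm, fun ht => ht ▸ h0⟩
    simp [this]
  · have := InformationTheory.kraft_mcmillan_inequality (S := s) (by
      intro L₁
      induction L₁ with
      | nil =>
        rintro (_ | ⟨x, L₂⟩) - h₂ he
        · rfl
        · simp only [List.flatten_nil, List.flatten_cons] at he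
          have := List.append_eq_nil_iff.1 he.symm
          exact absurd (h₂ x (by simp)) (this.1 ▸ h0)
      | cons y L₁ ih =>
        rintro (_ | ⟨x, L₂⟩) h₁ h₂ he
        · simp only [List.flatten_nil, List.flatten_cons] at he
          have := List.append_eq_nil_iff.1 he
          exact absurd (h₁ y (by simp)) (this.1 ▸ h0)
        · simp only [List.flatten_cons] at he
          have hx := h₂ x (by simp)
          have hy := h₁ y (by simp)
          have hxy : y = x := by
            rcases List.append_eq_append_iff.1 he with ⟨a, ha, -⟩ | ⟨a, ha, -⟩
            · exact h _ hy _ hx ⟨a, ha.symm⟩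
            · exact (h _ hx _ hy ⟨a, ha.symm⟩).symm
          subst hxy
          rw [ih L₂ (fun w hw => h₁ w (by simp [hw])) (fun w hw => h₂ w (by simp [hw]))
            (List.append_cancel_left he)])
    simpa using this

/-! ### Enumerations of partial recursive functions -/

open Nat.Partrec (Code) in
/-- The graph of a partial recursive function has a primitive recursive enumeration without
repetitions. -/
theorem exists_enumeration {α β : Type*} [Primcodable α] [Primcodable β] {g : α →. β}
    (hg : Partrec g) :
    ∃ e : ℕ → Option (α × β), Primrec e ∧ (∀ a b, b ∈ g a ↔ ∃ i, e i = some (a, b)) ∧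
      ∀ i j x, e i = some x → e j = some x → i = j := by
  obtain ⟨c, hc⟩ := Code.exists_code.1 (Partrec.bind_decode₂_iff.1 hg)
  let ev : ℕ → ℕ → Option ℕ := fun s n => Code.evaln s c n
  have hev : Primrec₂ ev :=
    Code.primrec_evaln.comp (Primrec.pair (Primrec.pair Primrec.fst (Primrec.const c)) Primrec.snd)
  -- The index codes an input and a step count `s`. A value is emitted only if `s` steps do not
  -- suffice and `s + 1` do, hence exactly once for each convergent input.
  let e : ℕ → Option (α × β) := fun i =>
    if ev i.unpair.2 i.unpair.1 = none then
      (ev (i.unpair.2 + 1) i.unpair.1).bind fun y =>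
        (Encodable.decode₂ α i.unpair.1).bind fun a => (Encodable.decode (α := β) y).map fun b =>
          (a, b)
    else none
  have hev_mem : ∀ a b, b ∈ g a ↔ ∃ s, Encodable.encode b ∈ ev s (Encodable.encode a) := by
    intro a b
    rw [← Code.evaln_complete, hc]
    simp
  have hsound : ∀ s a y, y ∈ ev s (Encodable.encode a) → ∃ b ∈ g a, Encodable.encode b = y := by
    intro s a y hy
    have := Code.evaln_sound hy
    rw [hc] at this
    simpa [Encodable.encodek₂] using this
  have hiff : ∀ i a b, e i = some (a, b) ↔ i.unpair.1 = Encodable.encode a ∧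
      ev i.unpair.2 i.unpair.1 = none ∧ Encodable.encode b ∈ ev (i.unpair.2 + 1) i.unpair.1 := by
    intro i a b
    simp only [e]
    split_ifs with h0
    · simp only [h0, Option.bind_eq_some_iff, Option.map_eq_some_iff, Prod.mk.injEq, true_and,
        Encodable.decode₂_eq_some]
      constructor
      · rintro ⟨y, hy, a', ha', b', hb', rfl, rfl⟩
        refine ⟨ha'.symm, ?_⟩
        rw [← ha'] at hy ⊢
        obtain ⟨b'', -, rfl⟩ := hsound _ _ _ hy
        rw [Encodable.encodek] at hb'
        cases hb'
        exact hy
      · rintro ⟨h1, h2⟩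
        exact ⟨_, h2, a, h1.symm, b, Encodable.encodek b, rfl, rfl⟩
    · simp [h0]
  refine ⟨e, ?_, ?_, ?_⟩
  · have u1 : Primrec fun i : ℕ => i.unpair.1 := Primrec.fst.comp Primrec.unpair
    have u2 : Primrec fun i : ℕ => i.unpair.2 := Primrec.snd.comp Primrec.unpair
    refine Primrec.ite (Primrec.eq.comp (hev.comp u2 u1) (Primrec.const none)) ?_
      (Primrec.const none)
    refine Primrec.option_bind (hev.comp (Primrec.succ.comp u2) u1) (Primrec₂.mk ?_)
    refine Primrec.option_bind (Primrec.decode₂.comp (u1.comp Primrec.fst)) (Primrec₂.mk ?_)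
    refine Primrec.option_map (Primrec.decode.comp (Primrec.snd.comp Primrec.fst))
      (Primrec₂.mk ?_)
    exact Primrec.pair (Primrec.snd.comp Primrec.fst) Primrec.snd
  · intro a b
    rw [hev_mem]
    constructor
    · intro h
      classical
      have hs := Nat.find_spec h
      have hmin := fun t => Nat.find_min h (m := t)
      generalize Nat.find h = s at hs hmin
      cases s with
      | zero => simp [ev, Code.evaln] at hs
      | succ s =>
        refine ⟨Nat.pair (Encodable.encode a) s, (hiff _ _ _).2 ?_⟩
        simp only [Nat.unpair_pair, true_and]
        refine ⟨?_, hs⟩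
        by_contra hne
        obtain ⟨y, hy⟩ := Option.ne_none_iff_exists'.1 hne
        have hy' : y ∈ ev (s + 1) (Encodable.encode a) := Code.evaln_mono (Nat.le_succ s) hy
        have : y = Encodable.encode b := Option.mem_unique hy' hs
        exact hmin s (Nat.lt_succ_self s) (this ▸ hy)
    · rintro ⟨i, hi⟩
      obtain ⟨h1, -, h3⟩ := (hiff _ _ _).1 hi
      exact ⟨_, h1 ▸ h3⟩
  · rintro i j ⟨a, b⟩ hi hj
    obtain ⟨h1, h2, h3⟩ := (hiff _ _ _).1 hi
    obtain ⟨h1', h2', h3'⟩ := (hiff _ _ _).1 hj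
    rw [h1] at h2 h3
    rw [h1'] at h2' h3'
    have key : ∀ s t, ev s (Encodable.encode a) = none →
        Encodable.encode b ∈ ev (t + 1) (Encodable.encode a) → s ≤ t := by
      intro s t hs ht
      by_contra hlt
      have : Encodable.encode b ∈ ev s (Encodable.encode a) :=
        Code.evaln_mono (by omega) ht
      rw [hs] at this
      cases this
    have : i.unpair.2 = j.unpair.2 := le_antisymm (key _ _ h2 h3') (key _ _ h2' h3)
    rw [← Nat.pair_unpair i, ← Nat.pair_unpair j, h1, h1', this]

/-! ### The Kraft–Chaitin theorem -/

/-- The weight `2 ^ (-l)` of a request for a program of length `l`. -/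
def reqWeight {β : Type*} (o : Option (ℕ × β)) : ℕ × ℕ :=
  o.elim (0, 0) fun q => (1, q.1)

theorem primrec_reqWeight {β : Type*} [Primcodable β] :
    Primrec (reqWeight : Option (ℕ × β) → ℕ × ℕ) :=
  (Primrec.option_casesOn (f := fun _ => (0, 0)) (g := fun _ (q : ℕ × β) => ((1 : ℕ), q.1))
    Primrec.id (Primrec.const (0, 0))
    (Primrec.pair (Primrec.const 1) (Primrec.fst.comp Primrec.snd)).to₂).of_eq
    fun o => by cases o <;> rfl

/-- The interval of the cylinder of `x` is contained in the interval `[a, b]`. -/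
def FitsIn (x : List Bool) (a b : ℕ × ℕ) : Prop :=
  DyLe a (binVal x, x.length) ∧ DyLe (binVal x + 1, x.length) b

theorem dyadic_binVal_lt_succ (x : List Bool) :
    dyadic (binVal x, x.length) < dyadic (binVal x + 1, x.length) := by
  rw [dyadic_eq_ofReal, dyadic_eq_ofReal, ENNReal.ofReal_lt_ofReal_iff (by positivity)]
  push_cast
  gcongr
  simp

theorem dyadic_binVal_append (x y : List Bool) :
    dyadic (binVal x, x.length) ≤ dyadic (binVal (x ++ y), (x ++ y).length) ∧
      dyadic (binVal (x ++ y) + 1, (x ++ y).length) ≤ dyadic (binVal x + 1, x.length) := by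
  have := binVal_lt y
  simp only [← dyLe_iff, DyLe, binVal_append, List.length_append, pow_add]
  constructor
  · nlinarith [Nat.zero_le (binVal y * 2 ^ x.length)]
  · have h : binVal x * 2 ^ y.length + binVal y + 1 ≤ (binVal x + 1) * 2 ^ y.length := by
      rw [add_mul]; omega
    calc _ ≤ (binVal x + 1) * 2 ^ y.length * 2 ^ x.length := Nat.mul_le_mul_right _ h
      _ = _ := by ring

/-- Rounding the left endpoint up to a multiple of 2^{-(l+1)} costs less than half of the interval,
and the other half holds the cylinder. This is where the extra bit in Kraft–Chaitin arises. -/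
theorem exists_fitsIn (a : ℕ × ℕ) (l : ℕ) (h : dyadic (dyAdd a (1, l)) ≤ 1) :
    ∃ x : List Bool, x.length = l + 1 ∧ FitsIn x a (dyAdd a (1, l)) := by
  set s : ℝ := a.1 / 2 ^ a.2 with hs
  have hs0 : 0 ≤ s := by positivity
  have hsum : dyadic (dyAdd a (1, l)) = ENNReal.ofReal (s + 1 / 2 ^ l) := by
    rw [dyadic_dyAdd, dyadic_eq_ofReal, dyadic_eq_ofReal,
      ← ENNReal.ofReal_add (by positivity) (by positivity)]
    simp [hs]
  set v := ⌈s * 2 ^ (l + 1)⌉₊ with hv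
  have hv1 : s * 2 ^ (l + 1) ≤ v := Nat.le_ceil _
  have hv2 : (v : ℝ) < s * 2 ^ (l + 1) + 1 := Nat.ceil_lt_add_one (by positivity)
  have hpos : (0 : ℝ) < 2 ^ (l + 1) := by positivity
  have hup : ((v : ℝ) + 1) / 2 ^ (l + 1) ≤ s + 1 / 2 ^ l := by
    rw [div_le_iff₀ hpos, add_mul, pow_succ]
    have : 1 / (2 : ℝ) ^ l * (2 ^ l * 2) = 2 := by field_simp
    rw [this]
    rw [pow_succ] at hv2
    linarith
  have hlt : v < 2 ^ (l + 1) := by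
    rw [hsum, ENNReal.ofReal_le_one] at h
    have := hup.trans h
    rw [div_le_one hpos] at this
    exact_mod_cast (lt_add_one _).trans_le this
  obtain ⟨x, hx, hxv⟩ := exists_binVal_eq _ _ hlt
  refine ⟨x, hx, (dyLe_iff _ _).2 ?_, (dyLe_iff _ _).2 ?_⟩
  · rw [dyadic_eq_ofReal, dyadic_eq_ofReal, hx, hxv]
    apply ENNReal.ofReal_le_ofReal
    rwa [le_div_iff₀ hpos]
  · rw [hsum, dyadic_eq_ofReal, hx, hxv]
    apply ENNReal.ofReal_le_ofReal
    push_cast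
    exact hup

open Classical in
/-- Every computable sequence of requests of total weight at most `1` is served by a prefix-free
machine with programs one bit longer than requested. -/
theorem exists_machine_of_requests {r : ℕ → Option (ℕ × List Bool)} (hr : Computable r)
    (hsum : ∑' i, dyadic (reqWeight (r i)) ≤ 1) :
    ∃ M, IsPrefixFreeMachine M ∧
      ∀ i l σ, r i = some (l, σ) → ∃ x : List Bool, σ ∈ M x ∧ x.length = l + 1 := by
  -- Request `i` owns the interval from `S i` to `S (i + 1)`; its programs are the strings of the
  -- prescribed length whose cylinders lie inside it.
  set S : ℕ → ℕ × ℕ := dySum fun i => reqWeight (r i) with hS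
  have hSc : Computable S :=
    computable_dySum (α := ℕ) (w := fun _ i => reqWeight (r i))
      (primrec_reqWeight.to_comp.comp (hr.comp Computable.snd)).to₂ Computable.id
  have hSm : Monotone fun i => dyadic (S i) := monotone_dyadic_dySum _
  let Fit : List Bool × (ℕ × ℕ) × (ℕ × ℕ) → ℕ × List Bool → Prop := fun t q =>
    t.1.length = q.1 + 1 ∧ FitsIn t.1 t.2.1 t.2.2
  let look : List Bool × (ℕ × ℕ) × (ℕ × ℕ) → ℕ × List Bool → Option (List Bool) := fun t q =>
    if Fit t q then some q.2 else none
  have hlook : Primrec₂ look := by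
    have x : Primrec fun z : (List Bool × (ℕ × ℕ) × (ℕ × ℕ)) × (ℕ × List Bool) => z.1.1 :=
      Primrec.fst.comp Primrec.fst
    refine Primrec.ite (PrimrecPred.and ?_ (PrimrecPred.and ?_ ?_))
      (Primrec.option_some.comp (Primrec.snd.comp Primrec.snd)) (Primrec.const none)
    · exact Primrec.eq.comp (Primrec.list_length.comp x)
        (Primrec.succ.comp (Primrec.fst.comp Primrec.snd))
    · exact primrec_dyLe.comp (Primrec.fst.comp (Primrec.snd.comp Primrec.fst))
        (Primrec.pair (primrec_binVal.comp x) (Primrec.list_length.comp x))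
    · exact primrec_dyLe.comp
        (Primrec.pair (Primrec.succ.comp (primrec_binVal.comp x)) (Primrec.list_length.comp x))
        (Primrec.snd.comp (Primrec.snd.comp Primrec.fst))
  let step : List Bool → ℕ → Option (List Bool) := fun x i =>
    (r i).bind fun q => look (x, S i, S (i + 1)) q
  have hstep : Computable₂ step := by
    refine Computable.option_bind (hr.comp Computable.snd) (Computable₂.mk ?_)
    refine hlook.to_comp.comp ?_ Computable.snd
    have i : Computable fun z : (List Bool × ℕ) × (ℕ × List Bool) => z.1.2 :=
      Computable.snd.comp Computable.fst
    exact Computable.pair (Computable.fst.comp Computable.fst)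
      (Computable.pair (hSc.comp i) (hSc.comp (Computable.succ.comp i)))
  have hmem : ∀ x i σ, σ ∈ step x i ↔
      ∃ l, r i = some (l, σ) ∧ x.length = l + 1 ∧ FitsIn x (S i) (S (i + 1)) := by
    intro x i σ
    simp only [step, look, Fit, Option.mem_def, Option.bind_eq_some_iff, Prod.exists]
    constructor
    · rintro ⟨l, τ, h, h'⟩
      split_ifs at h' with hc
      cases h'
      exact ⟨l, h, hc⟩
    · rintro ⟨l, h, hc⟩
      exact ⟨l, σ, h, if_pos hc⟩
  -- The cylinders of comparable strings are nested and have positive length, whereas intervals of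
  -- different requests share at most an endpoint.
  have key : ∀ x y i j, FitsIn x (S i) (S (i + 1)) → FitsIn (x ++ y) (S j) (S (j + 1)) →
      i = j := by
    rintro x y i j ⟨h1, h2⟩ ⟨h3, h4⟩
    rw [dyLe_iff] at h1 h2 h3 h4
    obtain ⟨h5, h6⟩ := dyadic_binVal_append x y
    have h7 := dyadic_binVal_lt_succ (x ++ y)
    rcases lt_trichotomy i j with h | h | h
    · exact absurd (h7.trans_le (h6.trans (h2.trans ((hSm h).trans h3)))) (lt_irrefl _)
    · exact h
    · exact absurd (h7.trans_le (h4.trans ((hSm h).trans (h1.trans h5)))) (lt_irrefl _)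
  refine ⟨fun x => Nat.rfindOpt (step x), ⟨Partrec.rfindOpt hstep, ?_⟩, ?_⟩
  · rintro x _ hx hy ⟨y, rfl⟩
    obtain ⟨i, σ, hi⟩ := Nat.rfindOpt_dom.1 hx
    obtain ⟨j, τ, hj⟩ := Nat.rfindOpt_dom.1 hy
    obtain ⟨l, h1, h2, h3⟩ := (hmem _ _ _).1 hi
    obtain ⟨l', h1', h2', h3'⟩ := (hmem _ _ _).1 hj
    obtain rfl := key _ _ _ _ h3 h3'
    rw [h1] at h1'
    cases h1'
    rw [List.length_append] at h2'
    have : y = [] := List.eq_nil_of_length_eq_zero (by omega)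
    simp [this]
  · intro i l σ hi
    have hS1 : S (i + 1) = dyAdd (S i) (1, l) := by
      change dyAdd (S i) (reqWeight (r i)) = _
      rw [hi]; rfl
    obtain ⟨x, hx, hfit⟩ := exists_fitsIn (S i) l
      (hS1 ▸ (dyadic_dySum_le_tsum _ (i + 1)).trans hsum)
    rw [← hS1] at hfit
    refine ⟨x, ?_, hx⟩
    have hd : (Nat.rfindOpt (step x)).Dom :=
      Nat.rfindOpt_dom.2 ⟨i, σ, (hmem _ _ _).2 ⟨l, hi, hx, hfit⟩⟩
    obtain ⟨j, hj⟩ := Nat.rfindOpt_spec (Part.get_mem hd)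
    obtain ⟨l', h1, -, h3⟩ := (hmem _ _ _).1 hj
    obtain rfl : i = j := key x [] i j hfit (by simpa using h3)
    rw [hi] at h1
    have hval : (Nat.rfindOpt (step x)).get hd = σ := by
      injection h1 with h1
      exact (congrArg Prod.snd h1).symm
    exact hval ▸ Part.get_mem hd

/-! ### Complexity bounds -/

theorem K_le_length {U : List Bool →. List Bool} {σ τ : List Bool} (h : σ ∈ U τ) :
    K U σ ≤ τ.length :=
  Nat.sInf_le ⟨τ, rfl, h⟩

/-- The existence of a program is recorded separately because `K` is an infimum in ℕ, which would be
0 for the empty set. -/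
theorem exists_K_bound {U : List Bool →. List Bool} (hU : IsUniversalMachine U)
    {r : ℕ → Option (ℕ × List Bool)} (hr : Computable r)
    (hsum : ∑' i, dyadic (reqWeight (r i)) ≤ 1) :
    ∃ c : ℕ, ∀ i l σ, r i = some (l, σ) → (∃ τ, σ ∈ U τ) ∧ K U σ ≤ l + c := by
  obtain ⟨M, hM, hMr⟩ := exists_machine_of_requests hr hsum
  obtain ⟨c, hc⟩ := hU.2 M hM
  refine ⟨c + 1, fun i l σ hi => ?_⟩
  obtain ⟨x, hx, hxl⟩ := hMr i l σ hi
  obtain ⟨τ, hτ, hτl⟩ := hc x σ hx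
  exact ⟨⟨τ, hτ⟩, (K_le_length hτ).trans (by omega)⟩

theorem tsum_two_inv_pow_succ : ∑' i : ℕ, (2 : ℝ≥0∞)⁻¹ ^ (i + 1) = 1 := by
  simp_rw [pow_succ]
  rw [ENNReal.tsum_mul_right, ENNReal.tsum_geometric, ENNReal.one_sub_inv_two, inv_inv]
  exact ENNReal.mul_inv_cancel (by simp) (by simp)

/-- The members of a computable sequence of strings have complexity at most linear in their
index, with factor one. -/
theorem exists_K_le_index {U : List Bool →. List Bool} (hU : IsUniversalMachine U)
    {x : ℕ → List Bool} (hx : Computable x) :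
    ∃ c : ℕ, ∀ i, K U (x i) ≤ i + c := by
  obtain ⟨c, hc⟩ := exists_K_bound hU (r := fun i => some (i + 1, x i))
    (Computable.option_some.comp (Computable.pair Computable.succ hx)) (by
      simp only [reqWeight, Option.elim_some, dyadic_one]
      exact tsum_two_inv_pow_succ.le)
  exact ⟨c + 1, fun i => (hc i _ _ rfl).2.trans (by omega)⟩

theorem exists_program {U : List Bool →. List Bool} (hU : IsUniversalMachine U)
    (σ : List Bool) : ∃ τ, σ ∈ U τ ∧ τ.length = K U σ := by
  obtain ⟨c, hc⟩ := exists_K_bound hU (r := fun i => some (i + 1, σ))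
    (Computable.option_some.comp (Computable.pair Computable.succ (Computable.const σ))) (by
      simp only [reqWeight, Option.elim_some, dyadic_one]
      exact tsum_two_inv_pow_succ.le)
  obtain ⟨τ, hτ⟩ := (hc 0 _ _ rfl).1
  obtain ⟨τ', h, h'⟩ := Nat.sInf_mem (s := {n | ∃ τ : List Bool, τ.length = n ∧ σ ∈ U τ})
    ⟨_, τ, rfl, hτ⟩
  exact ⟨τ', h', h⟩

/-! ### Restrictions of sequences -/

@[simp]
theorem length_restrict (X : ℕ → Bool) (n : ℕ) : (restrict X n).length = n := by
  simp [restrict]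

theorem restrict_succ (X : ℕ → Bool) (n : ℕ) : restrict X (n + 1) = restrict X n ++ [X n] := by
  simp [restrict, List.range_succ]

theorem isInitial_restrict (X : ℕ → Bool) (n : ℕ) : IsInitial (restrict X n) X := by
  simp [IsInitial]

/-! ### Enumerations of the programs of a machine and the halting probability -/

/-- `e` is a primitive recursive enumeration without repetitions of the graph of `U`. -/
structure IsEnumeration (U : List Bool →. List Bool) (e : ℕ → Option (List Bool × List Bool)) :
    Prop where
  primrec : Primrec e
  mem_iff : ∀ p x, x ∈ U p ↔ ∃ i, e i = some (p, x)
  inj : ∀ i j a, e i = some a → e j = some a → i = j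

theorem exists_isEnumeration {U : List Bool →. List Bool} (hU : Partrec U) :
    ∃ e, IsEnumeration U e := by
  obtain ⟨e, h1, h2, h3⟩ := exists_enumeration hU
  exact ⟨e, h1, h2, h3⟩

/-- The weight `2 ^ (-|p|)` of an enumerated program `p`. -/
def progWeight (o : Option (List Bool × List Bool)) : ℕ × ℕ :=
  o.elim (0, 0) fun a => (1, a.1.length)

theorem primrec_progWeight : Primrec progWeight :=
  (Primrec.option_casesOn (f := fun _ => (0, 0))
    (g := fun _ (a : List Bool × List Bool) => ((1 : ℕ), a.1.length))
    Primrec.id (Primrec.const (0, 0))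
    (Primrec.pair (Primrec.const 1)
      (Primrec.list_length.comp (Primrec.fst.comp Primrec.snd))).to₂).of_eq
    fun o => by cases o <;> rfl

/-- The weight of the programs enumerated before stage `t`. -/
def omegaStage (e : ℕ → Option (List Bool × List Bool)) (t : ℕ) : ℕ × ℕ :=
  dySum (fun i => progWeight (e i)) t

theorem primrec_omegaStage {e : ℕ → Option (List Bool × List Bool)} (he : Primrec e) :
    Primrec (omegaStage e) :=
  (primrec_dySum (α := ℕ) (w := fun _ i => progWeight (e i))
    (primrec_progWeight.comp (he.comp Primrec.snd)).to₂).comp Primrec.id Primrec.id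

/-- The limit of the weights of the enumerated programs. -/
def omegaTotal (e : ℕ → Option (List Bool × List Bool)) : ℝ≥0∞ :=
  ∑' i, dyadic (progWeight (e i))

theorem omegaStage_succ_of_some {e : ℕ → Option (List Bool × List Bool)} {j : ℕ}
    {a : List Bool × List Bool} (h : e j = some a) {u : ℕ} (hu : u ≤ j) :
    dyadic (omegaStage e u) + 2⁻¹ ^ a.1.length ≤ dyadic (omegaStage e (j + 1)) := by
  have h1 : omegaStage e (j + 1) = dyAdd (omegaStage e j) (1, a.1.length) := by
    change dyAdd (omegaStage e j) (progWeight (e j)) = _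
    rw [h]; rfl
  rw [h1, dyadic_dyAdd, dyadic_one]
  gcongr
  exact monotone_dyadic_dySum _ hu

namespace IsEnumeration

variable {U : List Bool →. List Bool} {e : ℕ → Option (List Bool × List Bool)}

/-- As the enumeration has no repetitions and a program has only one output, each halting program is
counted exactly once. -/
theorem omegaTotal_eq (he : IsEnumeration U e) :
    omegaTotal e = ∑' p : {p : List Bool // (U p).Dom}, (2 : ℝ≥0∞)⁻¹ ^ p.1.length := by
  have hex : ∀ p : {p : List Bool // (U p).Dom}, ∃ i x, e i = some (p.1, x) := fun p => by
    obtain ⟨i, hi⟩ := (he.mem_iff _ _).1 (Part.get_mem p.2)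
    exact ⟨i, _, hi⟩
  choose g x hg using hex
  have hinj : Function.Injective g := by
    intro p q hpq
    have h1 := hg p
    rw [hpq, hg q] at h1
    exact Subtype.ext (by simpa using (congrArg (fun o => o.map Prod.fst) h1.symm))
  rw [omegaTotal, ← hinj.tsum_eq]
  · exact tsum_congr fun p => by rw [hg p]; exact dyadic_one _
  · intro i hi
    cases h : e i with
    | none => simp [h, progWeight, dyadic] at hi
    | some a =>
      have hmem : a.2 ∈ U a.1 := (he.mem_iff _ _).2 ⟨i, h⟩
      have hd : (U a.1).Dom := Part.dom_iff_mem.2 ⟨_, hmem⟩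
      refine ⟨⟨a.1, hd⟩, he.inj _ _ _ (hg ⟨a.1, hd⟩) ?_⟩
      have h2 : x ⟨a.1, hd⟩ ∈ U a.1 := (he.mem_iff _ _).2 ⟨_, hg ⟨a.1, hd⟩⟩
      rw [h, Part.mem_unique h2 hmem]

theorem omegaTotal_le_one (he : IsEnumeration U e) (hU : IsPrefixFreeMachine U) :
    omegaTotal e ≤ 1 := by
  rw [he.omegaTotal_eq, ENNReal.tsum_eq_iSup_sum]
  refine iSup_le fun s => ?_
  have h := sum_le_one_of_prefixFree (s.map (Function.Embedding.subtype _)) (by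
    simp only [Finset.mem_map, Function.Embedding.subtype_apply]
    rintro _ ⟨σ, -, rfl⟩ _ ⟨τ, -, rfl⟩ hp
    exact hU.2 _ _ σ.2 τ.2 hp)
  rw [Finset.sum_map] at h
  have h2 := ENNReal.ofReal_le_ofReal h
  rw [ENNReal.ofReal_one, ENNReal.ofReal_sum_of_nonneg (fun _ _ => by positivity)] at h2
  refine le_of_eq_of_le (Finset.sum_congr rfl fun p _ => ?_) h2
  rw [ENNReal.ofReal_pow (by positivity), ENNReal.ofReal_inv_of_pos (by norm_num)]
  simp

theorem omegaReal_eq (he : IsEnumeration U e) : omegaReal U = (omegaTotal e).toReal := by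
  rw [he.omegaTotal_eq, ENNReal.tsum_toReal_eq (by simp), omegaReal]
  simp

/-- If Ω were 1, a stage with Ω_u ≥ 1 − 2^{-n} could be computed from n. A string longer than all
outputs before that stage has only later programs, which have length at least n; a computable
sequence of strings cannot have such complexities. -/
theorem omegaTotal_lt_one (he : IsEnumeration U e) (hU : IsUniversalMachine U) :
    omegaTotal e < 1 := by
  classical
  refine lt_of_le_of_ne (he.omegaTotal_le_one hU.1) fun hone => ?_
  let P : ℕ → ℕ → Prop := fun n u => DyLe (1, 0) (dyAdd (omegaStage e u) (1, n))
  have hPiff : ∀ n u, P n u ↔ 1 ≤ dyadic (omegaStage e u) + 2⁻¹ ^ n := fun n u => by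
    simp only [P]
    rw [dyLe_iff, dyadic_dyAdd, dyadic_one, dyadic_one, pow_zero]
  have hPex : ∀ n, ∃ u, P n u := fun n => by
    have hlt : 1 - 2⁻¹ ^ n < omegaTotal e := by
      rw [hone]
      exact ENNReal.sub_lt_self (by simp) (by simp) (by simp)
    obtain ⟨u, hu⟩ := ((tendsto_dyadic_dySum _).eventually (lt_mem_nhds hlt)).exists
    exact ⟨u, (hPiff n u).2 (tsub_le_iff_right.1 hu.le)⟩
  have hPc : ComputablePred fun p : ℕ × ℕ => P p.1 p.2 :=
    PrimrecPred.computablePred (primrec_dyLe.comp (Primrec.const (1, 0))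
      (primrec_dyAdd.comp ((primrec_omegaStage he.primrec).comp Primrec.snd)
        (Primrec.pair (Primrec.const 1) Primrec.fst)))
  have hfind := Computable.find hPc hPex
  let outLen : Option (List Bool × List Bool) → ℕ := fun o => o.elim 0 fun a => a.2.length
  have houtLen : Primrec outLen :=
    (Primrec.option_casesOn (f := fun _ => 0)
      (g := fun _ (a : List Bool × List Bool) => a.2.length) Primrec.id (Primrec.const 0)
      (Primrec.list_length.comp (Primrec.snd.comp Primrec.snd)).to₂).of_eq
      fun o => by cases o <;> rfl
  -- Starting the sum of output lengths at 1 makes `len u` strictly larger than the length of each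
  -- output before stage `u`.
  let len : ℕ → ℕ := fun u => Nat.rec 1 (fun i s => s + outLen (e i)) u
  have hlen : Primrec len :=
    Primrec.nat_rec₁ 1 (Primrec.nat_add.comp Primrec.snd
      (houtLen.comp (he.primrec.comp Primrec.fst))).to₂
  have hlen_lt : ∀ u j a, j < u → e j = some a → a.2.length < len u := by
    intro u j a hj ha
    induction u with
    | zero => omega
    | succ u ih =>
      have h1 : len (u + 1) = len u + outLen (e u) := rfl
      have hpos : 0 < len u := by
        clear ih hj h1
        induction u with
        | zero => exact Nat.one_pos
        | succ u ih => exact Nat.add_pos_left ih _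
      rcases Nat.lt_succ_iff_lt_or_eq.1 hj with h | rfl
      · have := ih h; omega
      · have h2 : outLen (e j) = a.2.length := by rw [ha]; rfl
        omega
  let x : ℕ → List Bool := fun n => (List.range (len (Nat.find (hPex n)))).map fun _ => true
  have hx : Computable x :=
    (Primrec.list_map Primrec.list_range (Primrec₂.const true)).to_comp.comp
      (hlen.to_comp.comp hfind)
  have hKx : ∀ n, n ≤ K U (x n) := by
    intro n
    obtain ⟨q, hq, hqK⟩ := exists_program hU (x n)
    obtain ⟨j, hj⟩ := (he.mem_iff _ _).1 hq
    have huj : Nat.find (hPex n) ≤ j := by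
      by_contra hlt
      have := hlen_lt _ _ _ (not_le.1 hlt) hj
      simp [x] at this
    have h1 := omegaStage_succ_of_some hj huj
    have h2 := (hPiff _ _).1 (Nat.find_spec (hPex n))
    have h3 : dyadic (omegaStage e (j + 1)) ≤ 1 := (dyadic_dySum_le_tsum _ _).trans hone.le
    have h4 := (ENNReal.add_le_add_iff_left (dyadic_ne_top _)).1 (h1.trans (h3.trans h2))
    exact hqK ▸ (two_inv_pow_le_iff _ _).1 h4
  -- Along even indices the lower bound 2i on the complexity collides with the upper bound i + c at
  -- i = c + 1.
  obtain ⟨c, hc⟩ := exists_K_le_index hU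
    (hx.comp (Primrec.nat_double.to_comp : Computable fun i : ℕ => 2 * i))
  have h1 := hc (c + 1)
  have h2 := hKx (2 * (c + 1))
  omega

/-- The digit expansion approximates its real only on [0, 1), so Ω < 1 is essential here. -/
theorem binVal_restrict_omega (he : IsEnumeration U e) (hU : IsUniversalMachine U) (n : ℕ) :
    dyadic (binVal (restrict (omega U) n), n) ≤ omegaTotal e ∧
      omegaTotal e ≤ dyadic (binVal (restrict (omega U) n), n) + 2⁻¹ ^ n := by
  have hlt := he.omegaTotal_lt_one hU
  have htop : omegaTotal e ≠ ∞ := hlt.ne_top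
  have hmem : omegaReal U ∈ Set.Ico 0 1 := by
    rw [he.omegaReal_eq]
    exact ⟨ENNReal.toReal_nonneg, by
      rw [← ENNReal.toReal_one]; exact (ENNReal.toReal_lt_toReal htop (by simp)).2 hlt⟩
  have hval : (binVal (restrict (omega U) n) : ℝ) / 2 ^ n =
      ∑ i ∈ Finset.range n, Real.ofDigitsTerm (Real.digits (omegaReal U) 2) i := by
    induction n with
    | zero => simp [restrict, binVal]
    | succ n ih =>
      rw [Finset.sum_range_succ, ← ih, restrict_succ, binVal_concat, Real.ofDigitsTerm, omega]
      have hd : ((decide (Real.digits (omegaReal U) 2 n = 1)).toNat : ℝ) =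
          ((Real.digits (omegaReal U) 2 n : ℕ) : ℝ) := by
        generalize Real.digits (omegaReal U) 2 n = d
        fin_cases d <;> simp
      push_cast
      rw [hd, pow_succ]
      field_simp
  have h1 := Real.sum_ofDigitsTerm_digits_le (b := 2) hmem n
  have h2 := Real.le_sum_ofDigitsTerm_digits (b := 2) hmem n
  rw [← hval] at h1 h2
  have hΩ : omegaTotal e = ENNReal.ofReal (omegaReal U) := by
    rw [he.omegaReal_eq, ENNReal.ofReal_toReal htop]
  rw [hΩ, dyadic_eq_ofReal, ← dyadic_one, dyadic_eq_ofReal,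
    ← ENNReal.ofReal_add (by positivity) (by positivity)]
  refine ⟨ENNReal.ofReal_le_ofReal h1, ENNReal.ofReal_le_ofReal ?_⟩
  simp only [Nat.cast_one, Nat.cast_ofNat, inv_pow, one_div] at h2 ⊢
  linarith

end IsEnumeration

/-! ### Approximating the canonical tree of an effectively closed class -/

theorem primrecRel_exists_lt {β : Type*} [Primcodable β] {R : ℕ → β → Prop} (hR : PrimrecRel R) :
    PrimrecRel fun n y => ∃ x < n, R x y :=
  (hR.exists_mem_list.comp (Primrec.list_range.comp Primrec.fst) Primrec.snd).of_eq (by simp)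

theorem primrecRel_forall_lt {β : Type*} [Primcodable β] {R : ℕ → β → Prop} (hR : PrimrecRel R) :
    PrimrecRel fun n y => ∀ x < n, R x y :=
  (hR.forall_mem_list.comp (Primrec.list_range.comp Primrec.fst) Primrec.snd).of_eq (by simp)

/-- The list of all strings of length `n`. -/
def strings (n : ℕ) : List (List Bool) :=
  Nat.rec [[]] (fun _ L => L.map (List.cons true) ++ L.map (List.cons false)) n

theorem mem_strings {n : ℕ} {ρ : List Bool} : ρ ∈ strings n ↔ ρ.length = n := by
  induction n generalizing ρ with
  | zero => simp [strings]
  | succ n ih =>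
    change ρ ∈ (strings n).map _ ++ (strings n).map _ ↔ _
    cases ρ with
    | nil => simp
    | cons b ρ => cases b <;> simp [ih]

theorem primrec_strings : Primrec strings := by
  have h : ∀ b : Bool, Primrec fun z : ℕ × List (List Bool) => z.2.map (List.cons b) := fun b =>
    Primrec.list_map Primrec.snd (Primrec.list_cons.comp (Primrec.const b) Primrec.snd).to₂
  exact Primrec.nat_rec₁ _ (Primrec.list_append.comp (h true) (h false)).to₂

/-- Every extension of `τ` by `u` bits has a prefix among the first `u` entries of `s`. -/
def Covered (s : ℕ → Option (List Bool)) (τ : List Bool) (u : ℕ) : Prop :=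
  ∀ ρ ∈ strings u, ∃ i < u, ∃ x, s i = some x ∧ x <+: τ ++ ρ

theorem primrec_covered {s : ℕ → Option (List Bool)} (hs : Primrec s) :
    PrimrecRel (Covered s) := by
  classical
  have h1 : PrimrecRel fun (i : ℕ) (y : List Bool) => ∃ x, s i = some x ∧ x <+: y := by
    have hb : Primrec₂ fun (i : ℕ) (y : List Bool) =>
        (Option.casesOn (s i) false fun x => decide (x = y.take x.length) : Bool) := by
      refine Primrec.option_casesOn (hs.comp Primrec.fst) (Primrec.const false)
        (Primrec₂.mk (PrimrecPred.decide (Primrec.eq.comp Primrec.snd ?_)))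
      exact Primrec.list_take.comp (Primrec.list_length.comp Primrec.snd)
        (Primrec.snd.comp Primrec.fst)
    refine PrimrecRel.of_eq (Primrec.eq.comp₂ hb (Primrec₂.const true)) fun i y => ?_
    cases s i <;> simp [List.prefix_iff_eq_take]
  have h2 : PrimrecRel fun (ρ : List Bool) (z : List Bool × ℕ) =>
      ∃ i < z.2, ∃ x, s i = some x ∧ x <+: z.1 ++ ρ := by
    have hu : Primrec fun z : List Bool × List Bool × ℕ => z.2.2 := Primrec.snd.comp Primrec.snd
    have hy : Primrec fun z : List Bool × List Bool × ℕ => z.2.1 ++ z.1 :=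
      Primrec.list_append.comp (Primrec.fst.comp Primrec.snd) Primrec.fst
    exact (primrecRel_exists_lt h1).comp hu hy
  exact h2.forall_mem_list.comp (primrec_strings.comp Primrec.snd) Primrec.id

theorem isInitial_iff {σ : List Bool} {X : ℕ → Bool} :
    IsInitial σ X ↔ ∀ i : Fin σ.length, X i = σ[i] := by
  constructor
  · intro h i
    have h' : restrict X σ.length = σ := h
    have := List.getElem_of_eq h' (by simp : (i : ℕ) < (restrict X σ.length).length)
    simpa [restrict] using this
  · intro h
    refine List.ext_getElem (by simp) fun i h1 h2 => ?_
    simpa [restrict] using h ⟨i, h2⟩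

theorem isInitial_of_prefix {σ τ : List Bool} {X : ℕ → Bool} (h : σ <+: τ)
    (hτ : IsInitial τ X) : IsInitial σ X := by
  rw [isInitial_iff] at hτ ⊢
  intro i
  have := hτ ⟨i, i.2.trans_le h.length_le⟩
  simpa [h.getElem i.2] using this

theorem prefix_of_isInitial {σ τ : List Bool} {X : ℕ → Bool} (hσ : IsInitial σ X)
    (hτ : IsInitial τ X) (h : σ.length ≤ τ.length) : σ <+: τ := by
  rw [List.prefix_iff_eq_take]
  refine List.ext_getElem (by simp [h]) fun i h1 h2 => ?_
  rw [isInitial_iff] at hσ hτ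
  have e1 := hσ ⟨i, h1⟩
  have e2 := hτ ⟨i, h1.trans_le h⟩
  simp only [Fin.getElem_fin] at e1 e2
  simp [← e1, ← e2]

theorem exists_isInitial (σ : List Bool) : ∃ X, IsInitial σ X :=
  ⟨fun i => σ.getD i false, isInitial_iff.2 fun i => by simp⟩

theorem isClopen_isInitial (σ : List Bool) : IsClopen {X : ℕ → Bool | IsInitial σ X} := by
  simp only [isInitial_iff, Set.ofPred_forall]
  exact isClopen_iInter_of_finite fun i =>
    (isClopen_discrete {σ[i]}).preimage (continuous_apply (i : ℕ))

section Tree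

variable {C : Set (ℕ → Bool)} {s : ℕ → Option (List Bool)}

/-- A member of `C` through τ gives an extension of τ by u bits none of whose prefixes is ever
enumerated into the complement. -/
theorem not_covered (hC : Cᶜ = {X | ∃ i x, s i = some x ∧ IsInitial x X}) {τ : List Bool}
    (hτ : τ ∈ canonicalTree C) (u : ℕ) : ¬ Covered s τ u := by
  obtain ⟨X, hX, hτX⟩ := hτ
  intro h
  have hext : IsInitial (τ ++ (restrict X (τ.length + u)).drop τ.length) X := by
    have h1 : τ <+: restrict X (τ.length + u) :=
      prefix_of_isInitial hτX (isInitial_restrict _ _) (by simp)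
    obtain ⟨ρ, hρ⟩ := h1
    rw [← hρ, List.drop_left, hρ]
    exact isInitial_restrict _ _
  obtain ⟨i, -, x, hx, hp⟩ := h _ (mem_strings.2
    (by simp : ((restrict X (τ.length + u)).drop τ.length).length = u))
  have : X ∈ Cᶜ := by
    rw [hC]
    exact ⟨i, x, hx, isInitial_of_prefix hp hext⟩
  exact this hX

/-- If no member of `C` extends τ, the enumerated cylinders cover the compact cylinder of τ, so
finitely many of them do. -/
theorem eventually_covered (hC : Cᶜ = {X | ∃ i x, s i = some x ∧ IsInitial x X})
    {τ : List Bool} (hτ : τ ∉ canonicalTree C) : ∀ᶠ u in Filter.atTop, Covered s τ u := by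
  -- Bounding the length of `x` by `u` ensures that `x` is a prefix of every extension of τ by at
  -- least `u` bits along the sequence.
  let V : ℕ → Set (ℕ → Bool) := fun u =>
    {X | ∃ i x, (i < u ∧ s i = some x ∧ x.length ≤ u) ∧ IsInitial x X}
  have hVm : Monotone V := by
    rintro u v huv X ⟨i, x, ⟨h1, h2, h3⟩, h4⟩
    exact ⟨i, x, ⟨h1.trans_le huv, h2, h3.trans huv⟩, h4⟩
  have hVo : ∀ u, IsOpen (V u) := fun u => by
    have : V u = ⋃ (i : ℕ) (x : List Bool) (_ : i < u ∧ s i = some x ∧ x.length ≤ u),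
        {X | IsInitial x X} := by
      ext X; simp only [V, Set.mem_iUnion, Set.mem_ofPred_eq, exists_prop]
    rw [this]
    exact isOpen_iUnion fun i => isOpen_iUnion fun x => isOpen_iUnion fun _ =>
      (isClopen_isInitial x).isOpen
  have hcov : {X | IsInitial τ X} ⊆ ⋃ u, V u := by
    intro X hX
    have : X ∈ Cᶜ := fun hXC => hτ ⟨X, hXC, hX⟩
    rw [hC] at this
    obtain ⟨i, x, hx, hxX⟩ := this
    exact Set.mem_iUnion.2 ⟨max (i + 1) x.length, i, x,
      ⟨Nat.lt_of_succ_le (le_max_left _ _), hx, le_max_right _ _⟩, hxX⟩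
  obtain ⟨u, hu⟩ := (isClopen_isInitial τ).isClosed.isCompact.elim_directed_cover V hVo hcov
    hVm.directed_le
  filter_upwards [Filter.eventually_ge_atTop u] with v hv ρ hρ
  obtain ⟨X, hX⟩ := exists_isInitial (τ ++ ρ)
  obtain ⟨i, x, ⟨h1, h2, h3⟩, h4⟩ :=
    hVm hv (hu (show X ∈ {X | IsInitial τ X} from
      isInitial_of_prefix (List.prefix_append τ ρ) hX))
  refine ⟨i, h1, x, h2, prefix_of_isInitial h4 hX ?_⟩
  rw [List.length_append, mem_strings.1 hρ]
  omega

/-- There are only finitely many strings of length `k`, so one stage serves all of them. -/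
theorem eventually_covered_level (hC : Cᶜ = {X | ∃ i x, s i = some x ∧ IsInitial x X})
    (k : ℕ) : ∀ᶠ u in Filter.atTop, ∀ τ : List Bool, τ.length = k → ¬ Covered s τ u →
      τ ∈ level (canonicalTree C) k := by
  have h : ∀ᶠ u in Filter.atTop, ∀ τ ∈ {τ : List Bool | τ.length = k}, ¬ Covered s τ u →
      τ ∈ level (canonicalTree C) k := by
    rw [Filter.eventually_all_finite (List.finite_length_eq Bool k)]
    intro τ hτ
    by_cases hT : τ ∈ canonicalTree C
    · exact Filter.Eventually.of_forall fun _ _ => ⟨hT, hτ⟩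
    · filter_upwards [eventually_covered hC hT] with u hu h
      exact absurd hu h
  exact h

end Tree

/-! ### The a priori semi-measure of a machine -/

open Classical in
/-- The weight of an enumerated program if its output satisfies `P`, and zero otherwise. -/
def selWeight (P : List Bool → Prop) (o : Option (List Bool × List Bool)) : ℕ × ℕ :=
  o.elim (0, 0) fun a => if P a.2 then (1, a.1.length) else (0, 0)

theorem primrec_selWeight {α : Type*} [Primcodable α] {P : α → List Bool → Prop}
    (hP : PrimrecRel P) : Primrec₂ fun a o => selWeight (P a) o := by
  classical
  refine (Primrec.option_casesOn (f := fun _ => (0, 0))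
    (g := fun (z : α × Option (List Bool × List Bool)) (a : List Bool × List Bool) =>
      if P z.1 a.2 then ((1 : ℕ), a.1.length) else (0, 0))
    Primrec.snd (Primrec.const (0, 0)) (Primrec₂.mk ?_)).of_eq ?_
  · exact Primrec.ite (hP.comp (Primrec.fst.comp Primrec.fst) (Primrec.snd.comp Primrec.snd))
      (Primrec.pair (Primrec.const 1) (Primrec.list_length.comp (Primrec.fst.comp Primrec.snd)))
      (Primrec.const (0, 0))
  · rintro ⟨a, _ | o⟩
    · rfl
    · simp [selWeight]

theorem dyadic_selWeight_mono {P Q : List Bool → Prop} {o : Option (List Bool × List Bool)}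
    (h : ∀ τ, P τ → Q τ) : dyadic (selWeight P o) ≤ dyadic (selWeight Q o) := by
  cases o with
  | none => rfl
  | some a =>
    by_cases hP : P a.2
    · simp [selWeight, hP, h _ hP]
    · simp [selWeight, hP, dyadic]

theorem dyadic_selWeight_le {P : List Bool → Prop} {o : Option (List Bool × List Bool)} :
    dyadic (selWeight P o) ≤ dyadic (progWeight o) := by
  refine (dyadic_selWeight_mono (Q := fun _ => True) fun _ _ => trivial).trans (le_of_eq ?_)
  cases o <;> simp [selWeight, progWeight]

theorem tsum_dyadic_selWeight_eq (P : List Bool → Prop)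
    (o : Option (List Bool × List Bool)) :
    ∑' σ : {σ | P σ}, dyadic (selWeight (fun τ => τ = σ) o) = dyadic (selWeight P o) := by
  classical
  rw [tsum_subtype {σ | P σ} fun σ => dyadic (selWeight (fun τ => τ = σ) o)]
  cases o with
  | none => simp [selWeight, dyadic, Set.indicator]
  | some a =>
    rw [tsum_eq_single a.2]
    · by_cases h : P a.2 <;> simp [selWeight, Set.indicator, h, dyadic]
    · intro σ hσ
      simp [selWeight, Set.indicator, hσ.symm, dyadic]

/-- The probability that the enumerated machine outputs `σ`. -/
def outputProb (e : ℕ → Option (List Bool × List Bool)) (σ : List Bool) : ℝ≥0∞ :=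
  ∑' i, dyadic (selWeight (fun τ => τ = σ) (e i))

theorem tsum_outputProb (e : ℕ → Option (List Bool × List Bool)) (P : List Bool → Prop) :
    ∑' σ : {σ | P σ}, outputProb e σ = ∑' i, dyadic (selWeight P (e i)) := by
  simp only [outputProb]
  rw [ENNReal.tsum_comm]
  exact tsum_congr fun i => tsum_dyadic_selWeight_eq P (e i)

theorem IsEnumeration.isSemimeasureIn_outputProb {U : List Bool →. List Bool}
    {e : ℕ → Option (List Bool × List Bool)} (he : IsEnumeration U e)
    (hU : IsPrefixFreeMachine U) : IsSemimeasureIn ∅ (outputProb e) := by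
  constructor
  · have h := tsum_outputProb e fun _ => True
    rw [tsum_subtype {σ : List Bool | True} (outputProb e)] at h
    simp only [Set.ofPred_true, Set.indicator_univ] at h
    rw [h]
    exact (ENNReal.tsum_le_tsum fun i => dyadic_selWeight_le).trans (he.omegaTotal_le_one hU)
  · refine ⟨fun σ => dySum fun i => selWeight (fun τ => τ = σ) (e i), ?_, fun σ =>
      ⟨monotone_dyadic_dySum _, tendsto_dyadic_dySum _⟩⟩
    refine computableIn_empty_iff.2 (Primrec.to_comp ?_)
    refine primrec_dySum (w := fun σ i => selWeight (fun τ => τ = σ) (e i)) (Primrec₂.mk ?_)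
    exact (primrec_selWeight (P := fun σ τ : List Bool => τ = σ)
      (Primrec.eq.comp Primrec.snd Primrec.fst)).comp Primrec.fst (he.primrec.comp Primrec.snd)

/-- The output probability of the machine is itself a lower semi-computable semi-measure, so `m`
dominates it. Depth, a statement about `m`, thereby becomes a bound on weights of programs, with one
constant for all sets of outputs. -/
theorem IsEnumeration.exists_tsum_selWeight_le {U : List Bool →. List Bool}
    {e : ℕ → Option (List Bool × List Bool)} (he : IsEnumeration U e)
    (hU : IsPrefixFreeMachine U) {m : List Bool → ℝ≥0∞} (hm : IsUniversalSemimeasureIn ∅ m) :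
    ∃ b : ℕ, ∀ P : List Bool → Prop,
      ∑' i, dyadic (selWeight P (e i)) ≤ 2 ^ b * weight m {σ | P σ} := by
  obtain ⟨c, hc⟩ := hm.2 _ (he.isSemimeasureIn_outputProb hU)
  obtain ⟨b, hb⟩ := pow_unbounded_of_one_lt c (one_lt_two : (1 : ℝ≥0) < 2)
  refine ⟨b, fun P => ?_⟩
  rw [← tsum_outputProb, weight, ← ENNReal.tsum_mul_left]
  refine ENNReal.tsum_le_tsum fun σ => (hc σ).trans ?_
  gcongr
  exact_mod_cast hb.le

/-! ### Requests for joint descriptions -/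

/-- At the last index that passes the test, the `w`-mass added since `u` is at most δ, and it bounds
the `v`-mass added since `u`. -/
theorem sum_stopped_le {w v : ℕ → ℝ≥0∞} (hvw : ∀ j, v j ≤ w j) (hw : ∀ j, w j ≠ ∞) (u : ℕ)
    (δ : ℝ≥0∞) [DecidablePred fun j => ∑ i ∈ Finset.range (j + 1), w i ≤
      ∑ i ∈ Finset.range u, w i + δ] (N : ℕ) :
    ∑ j ∈ Finset.range N, (if ∑ i ∈ Finset.range (j + 1), w i ≤
      ∑ i ∈ Finset.range u, w i + δ then v j else 0) ≤ ∑ j ∈ Finset.range u, v j + δ := by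
  induction N with
  | zero => simp
  | succ N ih =>
    by_cases hc : ∑ i ∈ Finset.range (N + 1), w i ≤ ∑ i ∈ Finset.range u, w i + δ
    · refine (Finset.sum_le_sum (g := v) fun j _ => by split_ifs <;> simp).trans ?_
      rcases le_or_gt (N + 1) u with hN | hN
      · exact (Finset.sum_le_sum_of_subset (Finset.range_mono hN)).trans le_self_add
      · rw [← Finset.sum_range_add_sum_Ico _ hN.le] at hc ⊢
        have hfin : ∑ i ∈ Finset.range u, w i ≠ ∞ :=
          ENNReal.sum_ne_top.2 fun i _ => hw i
        gcongr
        exact (Finset.sum_le_sum fun j _ => hvw j).trans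
          ((ENNReal.add_le_add_iff_left hfin).1 hc)
    · rw [Finset.sum_range_succ, if_neg hc, add_zero]
      exact ih

section Requests

variable (e : ℕ → Option (List Bool × List Bool)) (s : ℕ → Option (List Bool)) (b : ℕ)

/-- The weight of the programs enumerated before stage `u` whose outputs are in the `k`-th level
of the stage `u` approximation of the tree. -/
def treeWeight (k u : ℕ) : ℕ × ℕ :=
  dySum (fun j => selWeight (fun τ => τ.length = k ∧ ¬ Covered s τ u) (e j)) u

/-- At stage `u` the halting probability has nearly reached the value of `z.2`, and the programs
for strings at level `z.1` of the tree have little weight. -/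
def StageGood (z : ℕ × List Bool) (u : ℕ) : Prop :=
  DyLe (binVal z.2, z.2.length) (dyAdd (omegaStage e u) (1, z.2.length)) ∧
    DyLe (treeWeight e s z.1 u) (2 ^ b, z.2.length)

/-- `u` is the first good stage. -/
def StageFirst (z : ℕ × List Bool) (u : ℕ) : Prop :=
  StageGood e s b z u ∧ ∀ v < u, ¬ StageGood e s b z v

/-- The `j`-th program `a.1` with output `a.2` gets a short description given `z.2`. -/
def Admissible (z : ℕ × List Bool) (a : List Bool × List Bool) (j u : ℕ) : Prop :=
  StageFirst e s b z u ∧ (a.2.length = z.1 ∧ ¬ Covered s a.2 u) ∧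
    DyLe (omegaStage e (j + 1)) (dyAdd (omegaStage e u) (2, z.2.length)) ∧
      z.2.length ≤ a.1.length + (b + 2)

open Classical in
/-- The request for a joint description of `a.2` and `a'.2`, at level `k` of the tree. -/
def requestBody (k : ℕ) (a a' : List Bool × List Bool) (j u : ℕ) :
    Option (ℕ × List Bool × List Bool) :=
  if Admissible e s b (k, a.2) a' j u then
    some (a.1.length + (a'.1.length + (b + 2) - a.2.length), a.2, a'.2)
  else none

/-- The requests for joint descriptions. -/
def request (f : ℕ → ℕ) (pair : List Bool × List Bool → List Bool) (i j u : ℕ) :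
    Option (ℕ × List Bool) :=
  (e i).bind fun a => (e j).bind fun a' =>
    (requestBody e s b (f a.2.length) a a' j u).map fun q => (q.1, pair q.2)

variable {e s b}

theorem primrec_stageGood (he : Primrec e) (hs : Primrec s) : PrimrecRel (StageGood e s b) := by
  have hΩ := primrec_omegaStage he
  have h1 : Primrec fun x : (ℕ × List Bool) × ℕ => x.1.2 := Primrec.snd.comp Primrec.fst
  have h2 : Primrec fun x : (ℕ × List Bool) × ℕ => x.1.2.length := Primrec.list_length.comp h1
  have hw : Primrec₂ fun (y : ℕ × ℕ) (j : ℕ) =>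
      selWeight (fun τ => τ.length = y.1 ∧ ¬ Covered s τ y.2) (e j) := by
    have hP : PrimrecRel fun (y : ℕ × ℕ) (τ : List Bool) =>
        τ.length = y.1 ∧ ¬ Covered s τ y.2 :=
      PrimrecPred.and
        (Primrec.eq.comp (Primrec.list_length.comp Primrec.snd) (Primrec.fst.comp Primrec.fst))
        (PrimrecPred.not ((primrec_covered hs).comp Primrec.snd (Primrec.snd.comp Primrec.fst)))
    exact (primrec_selWeight hP).comp Primrec.fst (he.comp Primrec.snd)
  have ht : Primrec₂ (treeWeight e s) :=
    (primrec_dySum hw).comp (Primrec.pair Primrec.fst Primrec.snd) Primrec.snd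
  refine PrimrecPred.and ?_ ?_
  · exact primrec_dyLe.comp (Primrec.pair (primrec_binVal.comp h1) h2)
      (primrec_dyAdd.comp (hΩ.comp Primrec.snd) (Primrec.pair (Primrec.const 1) h2))
  · exact primrec_dyLe.comp (ht.comp (Primrec.fst.comp Primrec.fst) Primrec.snd)
      (Primrec.pair (Primrec.const (2 ^ b)) h2)

theorem primrec_requestBody (he : Primrec e) (hs : Primrec s) :
    Primrec fun x : ℕ × (List Bool × List Bool) × (List Bool × List Bool) × ℕ × ℕ =>
      requestBody e s b x.1 x.2.1 x.2.2.1 x.2.2.2.1 x.2.2.2.2 := by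
  classical
  have hΩ := primrec_omegaStage he
  have hgood := primrec_stageGood (b := b) he hs
  let Tup := ℕ × (List Bool × List Bool) × (List Bool × List Bool) × ℕ × ℕ
  have t2 : Primrec fun x : Tup => x.2.2 := Primrec.snd.comp Primrec.snd
  have t3 : Primrec fun x : Tup => x.2.2.2 := Primrec.snd.comp t2
  have k : Primrec fun x : Tup => x.1 := Primrec.fst
  have a : Primrec fun x : Tup => x.2.1 := Primrec.fst.comp Primrec.snd
  have a' : Primrec fun x : Tup => x.2.2.1 := Primrec.fst.comp t2
  have j : Primrec fun x : Tup => x.2.2.2.1 := Primrec.fst.comp t3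
  have u : Primrec fun x : Tup => x.2.2.2.2 := Primrec.snd.comp t3
  have z : Primrec fun x : Tup => (x.1, x.2.1.2) := Primrec.pair k (Primrec.snd.comp a)
  have lσ : Primrec fun x : Tup => x.2.1.2.length :=
    Primrec.list_length.comp (Primrec.snd.comp a)
  have lq : Primrec fun x : Tup => x.2.2.1.1.length + (b + 2) :=
    Primrec.nat_add.comp (Primrec.list_length.comp (Primrec.fst.comp a')) (Primrec.const (b + 2))
  have hfirst : PrimrecRel (StageFirst e s b) :=
    PrimrecPred.and hgood ((primrecRel_forall_lt (hgood.swap.not)).comp Primrec.snd Primrec.fst)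
  refine Primrec.ite ?_ (Primrec.option_some.comp (Primrec.pair ?_
    (Primrec.pair (Primrec.snd.comp a) (Primrec.snd.comp a')))) (Primrec.const none)
  · refine PrimrecPred.and (hfirst.comp z u) (PrimrecPred.and (PrimrecPred.and ?_ ?_)
      (PrimrecPred.and ?_ ?_))
    · exact Primrec.eq.comp (Primrec.list_length.comp (Primrec.snd.comp a')) k
    · exact PrimrecPred.not ((primrec_covered hs).comp (Primrec.snd.comp a') u)
    · exact primrec_dyLe.comp (hΩ.comp (Primrec.succ.comp j))
        (primrec_dyAdd.comp (hΩ.comp u) (Primrec.pair (Primrec.const 2) lσ))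
    · exact Primrec.nat_le.comp lσ lq
  · exact Primrec.nat_add.comp (Primrec.list_length.comp (Primrec.fst.comp a))
      (Primrec.nat_sub.comp lq lσ)

theorem computable_request (he : Primrec e) (hs : Primrec s) {f : ℕ → ℕ} (hf : Computable f)
    {pair : List Bool × List Bool → List Bool} (hpair : Computable pair) :
    Computable fun x : ℕ × ℕ × ℕ => request e s b f pair x.1 x.2.1 x.2.2 := by
  refine Computable.option_bind (he.to_comp.comp Computable.fst) (Computable₂.mk ?_)
  refine Computable.option_bind (he.to_comp.comp (Computable.fst.comp
    (Computable.snd.comp Computable.fst))) (Computable₂.mk ?_)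
  refine Computable.option_map ((primrec_requestBody he hs).to_comp.comp
    (g := fun y : ((ℕ × ℕ × ℕ) × List Bool × List Bool) × List Bool × List Bool =>
      (f y.1.2.2.length, y.1.2, y.2, y.1.1.2.1, y.1.1.2.2)) ?_) (Computable₂.mk ?_)
  · have a : Computable fun y : ((ℕ × ℕ × ℕ) × List Bool × List Bool) × List Bool × List Bool =>
        y.1.2 := Computable.snd.comp Computable.fst
    have ju : Computable fun y : ((ℕ × ℕ × ℕ) × List Bool × List Bool) × List Bool × List Bool =>
        y.1.1.2 := Computable.snd.comp (Computable.fst.comp Computable.fst)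
    exact Computable.pair (hf.comp (Computable.list_length.comp (Computable.snd.comp a)))
      (Computable.pair a (Computable.pair Computable.snd ju))
  · exact Computable.pair (Computable.fst.comp Computable.snd)
      (hpair.comp (Computable.snd.comp Computable.snd))

theorem StageFirst.unique {z : ℕ × List Bool} {u v : ℕ} (hu : StageFirst e s b z u)
    (hv : StageFirst e s b z v) : u = v := by
  rcases lt_trichotomy u v with h | h | h
  · exact absurd hu.1 (hv.2 _ h)
  · exact h
  · exact absurd hv.1 (hu.2 _ h)

/-- The hypothesis keeps the natural subtraction from being truncated; the last clause of
`Admissible` supplies it. -/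
theorem two_inv_pow_add_sub {p q n d : ℕ} (h : n ≤ q + d) :
    (2 : ℝ≥0∞)⁻¹ ^ (p + (q + d - n)) = 2⁻¹ ^ p * (2 ^ n * 2⁻¹ ^ d) * 2⁻¹ ^ q := by
  obtain ⟨r, hr⟩ := Nat.exists_eq_add_of_le h
  have h1 : (2 : ℝ≥0∞) ^ n * 2⁻¹ ^ n = 1 := by
    rw [← mul_pow, ENNReal.mul_inv_cancel (by simp) (by simp), one_pow]
  calc (2 : ℝ≥0∞)⁻¹ ^ (p + (q + d - n)) = 2⁻¹ ^ p * 2⁻¹ ^ r := by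
        rw [hr, Nat.add_sub_cancel_left, pow_add]
    _ = 2⁻¹ ^ p * ((2 ^ n * 2⁻¹ ^ n) * 2⁻¹ ^ r) := by rw [h1, one_mul]
    _ = 2⁻¹ ^ p * (2 ^ n * 2⁻¹ ^ (q + d)) := by rw [hr, pow_add, mul_assoc]
    _ = _ := by rw [pow_add]; ring

theorem request_of_none {f : ℕ → ℕ} {pair : List Bool × List Bool → List Bool} {i j u : ℕ}
    (h : ∀ a a', e i = some a → e j = some a' →
      ¬ Admissible e s b (f a.2.length, a.2) a' j u) :
    dyadic (reqWeight (request e s b f pair i j u)) = 0 := by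
  have hn : request e s b f pair i j u = none := by
    cases hi : e i with
    | none => simp [request, hi]
    | some a =>
      cases hj : e j with
      | none => simp [request, hi, hj]
      | some a' => simp [request, hi, hj, requestBody, h a a' hi hj]
  rw [hn]
  exact dyadic_zero

theorem request_of_admissible {f : ℕ → ℕ} {pair : List Bool × List Bool → List Bool} {i j u : ℕ}
    {a a' : List Bool × List Bool} (hi : e i = some a) (hj : e j = some a')
    (h : Admissible e s b (f a.2.length, a.2) a' j u) :
    request e s b f pair i j u =
      some (a.1.length + (a'.1.length + (b + 2) - a.2.length), pair (a.2, a'.2)) := by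
  simp [request, hi, hj, requestBody, h]

/-- Given a program for σ, the served programs for level strings weigh at most 2^{b+2}·2^{-|σ|}, and
each request scales the weight of its program by the inverse of this factor. -/
theorem tsum_request_le (f : ℕ → ℕ) (pair : List Bool × List Bool → List Bool) (i : ℕ) :
    ∑' j, ∑' u, dyadic (reqWeight (request e s b f pair i j u)) ≤ dyadic (progWeight (e i)) := by
  classical
  cases hi : e i with
  | none =>
    have : ∀ j u, dyadic (reqWeight (request e s b f pair i j u)) = 0 := fun j u =>
      request_of_none fun a a' h => by rw [hi] at h; cases h
    simp [this]
  | some a =>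
    obtain ⟨p, σ⟩ := a
    by_cases hex : ∃ u, StageFirst e s b (f σ.length, σ) u
    · obtain ⟨u, hu⟩ := hex
      -- The first good stage is unique, so only one stage contributes requests.
      have hone : ∀ j, ∑' v, dyadic (reqWeight (request e s b f pair i j v)) =
          dyadic (reqWeight (request e s b f pair i j u)) := fun j =>
        tsum_eq_single u fun v hv => request_of_none fun a a' h _ hadm => by
          rw [hi] at h
          cases h
          exact hv (hadm.1.unique hu)
      simp only [hone]
      set P : List Bool → Prop := fun τ => τ.length = f σ.length ∧ ¬ Covered s τ u with hP
      set w : ℕ → ℝ≥0∞ := fun j => dyadic (progWeight (e j)) with hw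
      set v : ℕ → ℝ≥0∞ := fun j => dyadic (selWeight P (e j)) with hv
      set δ : ℝ≥0∞ := dyadic (2, σ.length) with hδ
      have hbound : ∀ j, dyadic (reqWeight (request e s b f pair i j u)) ≤
          2⁻¹ ^ p.length * (2 ^ σ.length * 2⁻¹ ^ (b + 2)) *
            (if ∑ i ∈ Finset.range (j + 1), w i ≤ ∑ i ∈ Finset.range u, w i + δ
              then v j else 0) := by
        intro j
        by_cases hadm : ∃ a', e j = some a' ∧ Admissible e s b (f σ.length, σ) a' j u
        · obtain ⟨a', hj, hadm⟩ := hadm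
          rw [request_of_admissible hi hj hadm]
          obtain ⟨-, h2, h3, h4⟩ := hadm
          rw [dyLe_iff, dyadic_dyAdd, omegaStage, omegaStage, dyadic_dySum, dyadic_dySum] at h3
          rw [if_pos h3]
          simp only [reqWeight, Option.elim_some, dyadic_one]
          rw [two_inv_pow_add_sub h4]
          gcongr
          simp only [hv, hj, selWeight, Option.elim_some]
          rw [if_pos (by exact h2), dyadic_one]
        · rw [request_of_none]
          · exact zero_le
          · intro a a' h hj hc
            rw [hi] at h
            cases h
            exact hadm ⟨a', hj, hc⟩
      refine (ENNReal.tsum_le_tsum hbound).trans ?_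
      rw [ENNReal.tsum_mul_left]
      have hsum : ∑' j, (if ∑ i ∈ Finset.range (j + 1), w i ≤ ∑ i ∈ Finset.range u, w i + δ
              then v j else 0) ≤ 2 ^ (b + 2) * 2⁻¹ ^ σ.length := by
        refine ENNReal.tsum_le_of_sum_range_le fun N => ?_
        refine (sum_stopped_le (fun j => dyadic_selWeight_le) (fun j => dyadic_ne_top _) u δ
          N).trans ?_
        -- Goodness of `u` bounds the mass before `u` by 2^b·2^{-|σ|}; the stopping rule allows δ =
        -- 2·2^{-|σ|} more.
        have ht := hu.1.2
        rw [dyLe_iff, treeWeight, dyadic_dySum] at ht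
        refine (add_le_add_left ht δ).trans ?_
        simp only [hδ, dyadic, ← ENNReal.inv_pow]
        rw [← ENNReal.add_div, div_eq_mul_inv]
        gcongr
        have : 2 ^ b + 2 ≤ 2 ^ (b + 2) := by
          have := Nat.one_le_two_pow (n := b)
          rw [pow_add]; omega
        exact_mod_cast this
      refine (mul_le_mul_right hsum _).trans (le_of_eq ?_)
      have h1 : ∀ n, (2 : ℝ≥0∞) ^ n * 2⁻¹ ^ n = 1 := fun n => by
        rw [← mul_pow, ENNReal.mul_inv_cancel (by simp) (by simp), one_pow]
      simp only [progWeight, Option.elim_some, dyadic_one]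
      calc _ = 2⁻¹ ^ p.length * ((2 : ℝ≥0∞) ^ σ.length * 2⁻¹ ^ σ.length) *
            (2 ^ (b + 2) * 2⁻¹ ^ (b + 2)) := by ring
        _ = _ := by rw [h1, h1, mul_one, mul_one]
    · have : ∀ j u, dyadic (reqWeight (request e s b f pair i j u)) = 0 := fun j u =>
        request_of_none fun a a' h _ hadm => by
          rw [hi] at h
          cases h
          exact hex ⟨u, hadm.1⟩
      simp [this]

end Requests

theorem tsum_unpair (F : ℕ → ℕ → ℕ → ℝ≥0∞) :
    ∑' N : ℕ, F N.unpair.1 N.unpair.2.unpair.1 N.unpair.2.unpair.2 =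
      ∑' i, ∑' j, ∑' u, F i j u := by
  have h : ∀ G : ℕ → ℕ → ℝ≥0∞, ∑' N : ℕ, G N.unpair.1 N.unpair.2 = ∑' i, ∑' j, G i j := by
    intro G
    rw [← ENNReal.tsum_prod, ← Nat.pairEquiv.symm.tsum_eq]
    rfl
  rw [h fun i M => F i M.unpair.1 M.unpair.2]
  exact tsum_congr fun i => h _

/-- The prefixes of the halting probability have nearly maximal information about the members of
a deep effectively closed class. -/
theorem exists_le_mutualInfo {U : List Bool →. List Bool} (hU : IsUniversalMachine U)
    (pair : List Bool × List Bool ≃ List Bool) (hpair : Computable pair)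
    {m : List Bool → ℝ≥0∞} (hm : IsUniversalSemimeasureIn ∅ m)
    {C : Set (ℕ → Bool)} (hC : IsPi01 C) {f : ℕ → ℕ} (hf : Computable f)
    (hdeep : ∀ n : ℕ, weight m (level (canonicalTree C) (f n)) < (2 : ℝ≥0∞)⁻¹ ^ n) :
    ∃ c : ℕ, ∀ Y ∈ C, ∀ n : ℕ,
      (n : ℤ) - c ≤ mutualInfo U pair (restrict (omega U) n) (restrict Y (f n)) := by
  obtain ⟨e, he⟩ := exists_isEnumeration hU.1.1
  obtain ⟨S, hS, hCS⟩ := hC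
  obtain ⟨s', hs', hs'S, -⟩ := exists_enumeration hS
  set s : ℕ → Option (List Bool) := fun i => (s' i).map Prod.fst with hsdef
  have hs : Primrec s := Primrec.option_map hs' (Primrec.fst.comp Primrec.snd).to₂
  have hC' : Cᶜ = {X | ∃ i x, s i = some x ∧ IsInitial x X} := by
    rw [hCS]
    ext X
    constructor
    · rintro ⟨σ, hσ, hX⟩
      obtain ⟨i, hi⟩ := (hs'S σ ()).1 (by simpa using hσ)
      exact ⟨i, σ, by simp [hsdef, hi], hX⟩
    · rintro ⟨i, σ, hi, hX⟩
      refine ⟨σ, ?_, hX⟩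
      obtain ⟨⟨σ', t⟩, h1, rfl⟩ := Option.map_eq_some_iff.1 hi
      simpa using (hs'S σ' t).2 ⟨i, h1⟩
  obtain ⟨b, hb⟩ := he.exists_tsum_selWeight_le hU.1 hm
  let r : ℕ → Option (ℕ × List Bool) := fun N =>
    request e s b f pair N.unpair.1 N.unpair.2.unpair.1 N.unpair.2.unpair.2
  have hr : Computable r := by
    have h2 : Computable fun N : ℕ => N.unpair.2.unpair :=
      Computable.unpair.comp (Computable.snd.comp Computable.unpair)
    exact (computable_request he.primrec hs hf hpair).comp
      (Computable.pair (Computable.fst.comp Computable.unpair) h2)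
  have hrsum : ∑' N, dyadic (reqWeight (r N)) ≤ 1 := by
    rw [tsum_unpair fun i j u => dyadic (reqWeight (request e s b f pair i j u))]
    exact (ENNReal.tsum_le_tsum fun i => tsum_request_le f pair i).trans
      (he.omegaTotal_le_one hU.1)
  obtain ⟨c, hc⟩ := exists_K_bound hU hr hrsum
  refine ⟨b + 2 + c, fun Y hY n => ?_⟩
  set σ := restrict (omega U) n with hσ
  set τ := restrict Y (f n) with hτ
  have hσl : σ.length = n := length_restrict _ _
  have hτl : τ.length = f n := length_restrict _ _
  have hτT : τ ∈ canonicalTree C := ⟨Y, hY, isInitial_restrict _ _⟩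
  obtain ⟨p, hp, hpK⟩ := exists_program hU σ
  obtain ⟨q, hq, hqK⟩ := exists_program hU τ
  obtain ⟨i, hi⟩ := (he.mem_iff _ _).1 hp
  obtain ⟨j, hj⟩ := (he.mem_iff _ _).1 hq
  obtain ⟨hΩ1, hΩ2⟩ := he.binVal_restrict_omega hU n
  rw [← hσ] at hΩ1 hΩ2
  have hlevel : ∑' i, dyadic (selWeight (fun τ => τ ∈ level (canonicalTree C) (f n)) (e i)) ≤
      dyadic (2 ^ b, n) := by
    refine (hb _).trans ?_
    rw [dyadic, div_eq_mul_inv, ENNReal.inv_pow]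
    push_cast
    gcongr
    exact (hdeep n).le
  -- Late enough, Ω_u is within 2^{-n} of Ω ≥ 0.σ, and the approximated level lies inside the true
  -- level, whose weight is small by depth.
  have hgood : ∃ u, StageGood e s b (f n, σ) u := by
    have h1 : ∀ᶠ u in Filter.atTop, dyadic (binVal σ, n) ≤
        dyadic (omegaStage e u) + 2⁻¹ ^ n := by
      have hlt : omegaTotal e - 2⁻¹ ^ n < omegaTotal e ∨ omegaTotal e = 0 := by
        rcases eq_or_ne (omegaTotal e) 0 with h | h
        · exact Or.inr h
        · exact Or.inl (ENNReal.sub_lt_self (he.omegaTotal_lt_one hU).ne_top h (by simp))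
      rcases hlt with hlt | h0
      · filter_upwards [(tendsto_dyadic_dySum fun i => progWeight (e i)).eventually
          (lt_mem_nhds hlt)] with u hu
        exact hΩ1.trans (tsub_le_iff_right.1 hu.le)
      · refine Filter.Eventually.of_forall fun u => (hΩ1.trans h0.le).trans zero_le
    obtain ⟨u, h1, h2⟩ := (h1.and (eventually_covered_level hC' (f n))).exists
    refine ⟨u, (dyLe_iff _ _).2 ?_, (dyLe_iff _ _).2 ?_⟩
    · simp only [hσl]
      rwa [dyadic_dyAdd, dyadic_one]
    · simp only [hσl]
      refine (dyadic_dySum_le_tsum _ _).trans (le_trans (ENNReal.tsum_le_tsum fun i =>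
        dyadic_selWeight_mono fun τ hτ => h2 τ hτ.1 hτ.2) hlevel)
  classical
  have hfirst : StageFirst e s b (f n, σ) (Nat.find hgood) :=
    ⟨Nat.find_spec hgood, fun v hv => Nat.find_min hgood hv⟩
  set u := Nat.find hgood
  -- The program `q` alone contributes 2^{-|q|} to the weight of its level, so depth forces it to be
  -- long.
  have hqn : n ≤ q.length + b := by
    have h1 : (2 : ℝ≥0∞)⁻¹ ^ q.length ≤ dyadic (2 ^ b, n) := by
      refine le_trans ?_ hlevel
      refine le_trans (le_of_eq ?_) (ENNReal.le_tsum j)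
      have : τ ∈ level (canonicalTree C) (f n) := ⟨hτT, hτl⟩
      simp only [hj, selWeight, Option.elim_some, this, if_true]
      rw [dyadic_one]
    rw [← dyadic_one, ← dyLe_iff, DyLe] at h1
    simp only [one_mul, ← pow_add] at h1
    have := (Nat.pow_le_pow_iff_right (by norm_num)).1 h1
    omega
  have hadm : Admissible e s b (f (p, σ).2.length, (p, σ).2) (q, τ) j u := by
    simp only [hσl]
    refine ⟨hfirst, ⟨hτl, not_covered hC' hτT u⟩, (dyLe_iff _ _).2 ?_, ?_⟩
    · have hg := (dyLe_iff _ _).1 hfirst.1.1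
      simp only [hσl] at hg ⊢
      rw [dyadic_dyAdd, dyadic_one] at hg
      rw [dyadic_dyAdd]
      -- Ω ≤ 0.σ + 2^{-n} ≤ Ω_u + 2·2^{-n}, so the stopping rule never excludes a program: this
      -- explains the 2 in `Admissible`.
      refine (dyadic_dySum_le_tsum _ _).trans (hΩ2.trans ((add_le_add_left hg _).trans ?_))
      rw [add_assoc, ← dyadic_one, ← dyadic_dyAdd]
      gcongr
      rw [dyadic_dyAdd]
      simp only [dyadic]
      rw [← ENNReal.add_div]
      norm_num
    · simp only [hσl]
      omega
  have hreq := request_of_admissible (pair := pair) hi hj hadm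
  have hK := (hc (Nat.pair i (Nat.pair j u)) _ _ (by
    simp only [r, Nat.unpair_pair]; exact hreq)).2
  simp only [hσl] at hK
  rw [mutualInfo]
  omega

/-! ### Semi-measures computable from a sequence -/

theorem computableIn_restrict (X : ℕ → Bool) : ComputableIn (oracle X) (restrict X) := by
  let G : ℕ → ℕ := fun k => Encodable.encode
    ((Encodable.decode (α := List Bool) k.unpair.1).getD [] ++ [decide (k.unpair.2 = 1)])
  have hG : Nat.Primrec G := by
    refine Primrec.nat_iff.1 (Primrec.encode.comp (Primrec.list_append.comp ?_ ?_))
    · exact Primrec.option_getD.comp (Primrec.decode.comp (Primrec.fst.comp Primrec.unpair))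
        (Primrec.const [])
    · exact Primrec.list_cons.comp (PrimrecPred.decide (Primrec.eq.comp
        (Primrec.snd.comp Primrec.unpair) (Primrec.const 1))) (Primrec.const [])
  have hX : Nat.RecursiveIn (oracle X) fun n => Part.some (X n).toNat := .oracle _ rfl
  have hstep := Nat.RecursiveIn.comp (hG.recursiveIn (O := oracle X))
    (.pair (.comp .right .right) (.comp hX (.comp .left .right)))
  have hrec := Nat.RecursiveIn.prec
    ((Nat.Primrec.const (Encodable.encode ([] : List Bool))).recursiveIn (O := oracle X)) hstep
  have hpair := Nat.RecursiveIn.pair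
    ((Nat.Primrec.const 0).recursiveIn (O := oracle X)) (Nat.Primrec.id.recursiveIn)
  have hcomp := Nat.RecursiveIn.comp hrec hpair
  refine hcomp.of_eq fun n => ?_
  simp only [Part.coe_some, id, Part.map_eq_map, Part.map_some, Seq.seq,
    Part.bind_eq_bind, Part.bind_some, Nat.unpair_pair, Encodable.decode_nat]
  induction n with
  | zero => rfl
  | succ n ih =>
    simp only [ih, Part.bind_some, restrict_succ]
    simp [G, Encodable.encodek]

/-- One oracle query followed by an ordinary computation is all the relativized computability that
is needed. -/
theorem ComputableIn.comp_oracle {α β γ : Type*} [Primcodable α] [Primcodable β] [Primcodable γ]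
    {O : Set (ℕ →. ℕ)} {G : ℕ → β} (hG : ComputableIn O G) {N : α → ℕ} (hN : Computable N)
    {h : α × β → γ} (hh : Computable h) : ComputableIn O fun a => h (a, G (N a)) := by
  have h1 := Nat.RecursiveIn.comp hG (hN.computableIn (O := O))
  have h2 := Nat.RecursiveIn.comp (hh.computableIn (O := O))
    (Nat.RecursiveIn.pair (Nat.Primrec.id.recursiveIn) h1)
  refine h2.of_eq fun n => ?_
  cases hn : Encodable.decode (α := α) n <;> simp [hn, Seq.seq]

open Classical in
/-- The weights `2 ^ (-(j + 1))` placed on the strings `X ↾ g j`. -/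
def prefixWeight (X : ℕ → Bool) (g : ℕ → ℕ) (σ : List Bool) (j : ℕ) : ℕ × ℕ :=
  if restrict X (g j) = σ then (1, j + 1) else (0, 0)

theorem take_restrict (X : ℕ → Bool) {k n : ℕ} (h : k ≤ n) :
    (restrict X n).take k = restrict X k := by
  simp [restrict, ← List.map_take, List.take_range, h]

/-- Monotonicity of `g` matters for computability: the i-th partial sum involves only prefixes of
X↾g(i), so that single string is the only oracle query. -/
theorem isSemimeasureIn_prefixWeight (X : ℕ → Bool) {g : ℕ → ℕ} (hg : Computable g)
    (hmono : Monotone g) :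
    IsSemimeasureIn (oracle X) fun σ => ∑' j, dyadic (prefixWeight X g σ j) := by
  classical
  constructor
  · rw [ENNReal.tsum_comm]
    refine le_trans (ENNReal.tsum_le_tsum fun j => ?_) tsum_two_inv_pow_succ.le
    rw [tsum_eq_single (restrict X (g j))]
    · simp [prefixWeight, dyadic_one]
    · intro σ hσ
      simp [prefixWeight, hσ.symm, dyadic]
  · refine ⟨fun σ => dySum (prefixWeight X g σ), ?_, fun σ =>
      ⟨monotone_dyadic_dySum _, tendsto_dyadic_dySum _⟩⟩
    let sel : List Bool × List Bool → ℕ → ℕ × ℕ := fun x j =>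
      if x.1 = x.2 then (1, j + 1) else (0, 0)
    have hsel : Primrec₂ sel :=
      Primrec.ite (Primrec.eq.comp (Primrec.fst.comp Primrec.fst) (Primrec.snd.comp Primrec.fst))
        (Primrec.pair (Primrec.const 1) (Primrec.succ.comp Primrec.snd)) (Primrec.const (0, 0))
    let h : (List Bool × ℕ) × List Bool → ℕ × ℕ := fun x =>
      dySum (fun j => sel (x.2.take (g j), x.1.1) j) x.1.2
    have hh : Computable h := by
      refine computable_dySum (w := fun (x : (List Bool × ℕ) × List Bool) j =>
        sel (x.2.take (g j), x.1.1) j) (Computable₂.mk ?_) (Computable.snd.comp Computable.fst)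
      exact hsel.to_comp.comp (Computable.pair
        (Primrec.list_take.to_comp.comp (hg.comp Computable.snd)
          (Computable.snd.comp Computable.fst))
        (Computable.fst.comp (Computable.fst.comp Computable.fst))) Computable.snd
    have hcomp := ComputableIn.comp_oracle (computableIn_restrict X)
      (hg.comp (Computable.snd : Computable (Prod.snd : List Bool × ℕ → ℕ))) hh
    have heq : (fun a : List Bool × ℕ => h (a, restrict X (g a.2))) =
        fun p => dySum (prefixWeight X g p.1) p.2 := by
      funext ⟨σ, i⟩
      simp only [h]
      suffices ∀ k ≤ i, dySum (fun j => sel ((restrict X (g i)).take (g j), σ) j) k =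
          dySum (prefixWeight X g σ) k from this i le_rfl
      intro k hk
      induction k with
      | zero => rfl
      | succ k ih =>
        change dyAdd (dySum _ k) _ = dyAdd (dySum _ k) _
        beta_reduce
        rw [ih (by omega), take_restrict X (hmono (by omega : k ≤ i))]
        rfl
    rw [heq] at hcomp
    exact hcomp

theorem exists_two_inv_pow_le {X : ℕ → Bool} {mX : List Bool → ℝ≥0∞}
    (hm : IsUniversalSemimeasureIn (oracle X) mX) {g : ℕ → ℕ} (hg : Computable g)
    (hmono : Monotone g) :
    ∃ c : ℝ≥0, ∀ j, (2 : ℝ≥0∞)⁻¹ ^ (j + 1) ≤ c * mX (restrict X (g j)) := by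
  obtain ⟨c, hc⟩ := hm.2 _ (isSemimeasureIn_prefixWeight X hg hmono)
  refine ⟨c, fun j => le_trans ?_ (hc _)⟩
  refine le_trans (le_of_eq ?_) (ENNReal.le_tsum j)
  simp [prefixWeight, dyadic_one]

theorem mutualInfoSeq_eq_top {U : List Bool →. List Bool}
    {pair : List Bool × List Bool ≃ List Bool} {X Y : ℕ → Bool} {f : ℕ → ℕ} (hf : Computable f)
    (hmono : Monotone f) {c : ℕ}
    (hc : ∀ n : ℕ, (n : ℤ) - c ≤ mutualInfo U pair (restrict X n) (restrict Y (f n)))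
    {mX mY : List Bool → ℝ≥0∞} (hX : IsUniversalSemimeasureIn (oracle X) mX)
    (hY : IsUniversalSemimeasureIn (oracle Y) mY) : mutualInfoSeq U pair mX mY = ⊤ := by
  -- The information at `g j` is at least 4j + 4, twice the 2(j + 1) lost to the two weights
  -- 2^{-(j+1)}; the constant `c` is absorbed.
  let g : ℕ → ℕ := fun j => 4 * j + (4 + c)
  have hg : Computable g := Primrec.to_comp (Primrec.nat_add.comp
    (Primrec.nat_mul.comp (Primrec.const 4) Primrec.id) (Primrec.const (4 + c)))
  have hgm : Monotone g := fun a b h => by simp only [g]; omega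
  obtain ⟨c₁, h₁⟩ := exists_two_inv_pow_le hX hg hgm
  obtain ⟨c₂, h₂⟩ := exists_two_inv_pow_le hY (hf.comp hg) (hmono.comp hgm)
  set S : ℝ≥0∞ := ∑' p : List Bool × List Bool,
    mX p.1 * mY p.2 * (2 : ℝ≥0∞) ^ mutualInfo U pair p.1 p.2 with hS
  have hterm : ∀ j : ℕ, (j : ℝ≥0∞) ≤ c₁ * c₂ * S := by
    intro j
    set σ := restrict X (g j)
    set τ := restrict Y (f (g j))
    have hI : (2 : ℝ≥0∞) ^ (4 * j + 4) ≤ 2 ^ mutualInfo U pair σ τ := by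
      rw [← zpow_natCast]
      refine ENNReal.zpow_le_of_le (by norm_num) (le_trans ?_ (hc (g j)))
      simp only [g]
      push_cast
      linarith
    have hj : (j : ℝ≥0∞) ≤ 2⁻¹ ^ (j + 1) * 2⁻¹ ^ (j + 1) * 2 ^ (4 * j + 4) := by
      have h1 : (2 : ℝ≥0∞) ^ (j + 1) * 2⁻¹ ^ (j + 1) = 1 := by
        rw [← mul_pow, ENNReal.mul_inv_cancel (by simp) (by simp), one_pow]
      have h2 : (2 : ℝ≥0∞)⁻¹ ^ (j + 1) * 2⁻¹ ^ (j + 1) * 2 ^ (4 * j + 4) =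
          2 ^ (2 * j + 2) := by
        calc _ = ((2 : ℝ≥0∞) ^ (j + 1) * 2⁻¹ ^ (j + 1)) * (2 ^ (j + 1) * 2⁻¹ ^ (j + 1)) *
              2 ^ (2 * j + 2) := by ring
          _ = _ := by rw [h1, one_mul, one_mul]
      rw [h2]
      have h3 : j ≤ 2 ^ (2 * j + 2) :=
        Nat.lt_two_pow_self.le.trans (Nat.pow_le_pow_right (by norm_num) (by omega))
      exact_mod_cast h3
    calc (j : ℝ≥0∞) ≤ 2⁻¹ ^ (j + 1) * 2⁻¹ ^ (j + 1) * 2 ^ (4 * j + 4) := hj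
      _ ≤ (c₁ * mX σ) * (c₂ * mY τ) * 2 ^ mutualInfo U pair σ τ := by
        gcongr
        · exact h₁ j
        · exact h₂ j
      _ = c₁ * c₂ * (mX σ * mY τ * 2 ^ mutualInfo U pair σ τ) := by ring
      _ ≤ c₁ * c₂ * S := by
        gcongr
        exact ENNReal.le_tsum (f := fun p : List Bool × List Bool =>
          mX p.1 * mY p.2 * (2 : ℝ≥0∞) ^ mutualInfo U pair p.1 p.2) (σ, τ)
  have hStop : S = ⊤ := by
    by_contra hne
    obtain ⟨j, hj⟩ := ENNReal.exists_nat_gt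
      (ENNReal.mul_ne_top (ENNReal.mul_ne_top ENNReal.coe_ne_top ENNReal.coe_ne_top) hne :
        (c₁ : ℝ≥0∞) * c₂ * S ≠ ⊤)
    exact absurd (hterm j) (not_le.2 hj)
  rw [mutualInfoSeq, ← hS, hStop, ENNReal.log_top]
  exact EReal.top_div_of_pos_ne_top (by exact_mod_cast Real.log_pos one_lt_two)
    (EReal.coe_ne_top _)

end AlgInfo

end

theorem mainTheorem12
    (U : List Bool →. List Bool) (hU : AlgInfo.IsUniversalMachine U)
    (pair : List Bool × List Bool ≃ List Bool) (hpair : Computable pair)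
    (m : List Bool → ENNReal) (hm : AlgInfo.IsUniversalSemimeasureIn ∅ m)
    (C : Set (ℕ → Bool)) (hC : AlgInfo.IsPi01 C)
    (f : ℕ → ℕ) (hf : Computable f) (hford : AlgInfo.IsOrder f)
    (hdeep : ∀ n : ℕ,
      AlgInfo.weight m (AlgInfo.level (AlgInfo.canonicalTree C) (f n)) < (2 : ENNReal)⁻¹ ^ n) :
    (∃ c : ℝ, ∀ Y ∈ C, ∀ n : ℕ,
      (n : ℝ) - c * Real.logb 2 (n + 2) ≤
        (AlgInfo.mutualInfo U pair (AlgInfo.restrict (AlgInfo.omega U) n)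
          (AlgInfo.restrict Y (f n)) : ℝ)) ∧
    ∀ Y ∈ C, ∀ mΩ mY : List Bool → ENNReal,
      AlgInfo.IsUniversalSemimeasureIn (AlgInfo.oracle (AlgInfo.omega U)) mΩ →
      AlgInfo.IsUniversalSemimeasureIn (AlgInfo.oracle Y) mY →
      AlgInfo.mutualInfoSeq U pair mΩ mY = ⊤ := by
  obtain ⟨c, hc⟩ := AlgInfo.exists_le_mutualInfo hU pair hpair hm hC hf hdeep
  refine ⟨⟨c, fun Y hY n => ?_⟩, fun Y hY mΩ mY hΩ hmY =>
    AlgInfo.mutualInfoSeq_eq_top hf hford.1 (hc Y hY) hΩ hmY⟩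
  -- Since the logarithm is at least 1, a constant loss is within the allowed logarithmic loss.
  have h1 : (1 : ℝ) ≤ Real.logb 2 (n + 2) := by
    rw [Real.le_logb_iff_rpow_le (by norm_num) (by positivity), Real.rpow_one]
    have : (0 : ℝ) ≤ n := Nat.cast_nonneg n
    linarith
  have h2 := Int.cast_le (R := ℝ) |>.2 (hc Y hY n)
  have h3 : (c : ℝ) ≤ c * Real.logb 2 (n + 2) := le_mul_of_one_le_right (Nat.cast_nonneg c) h1
  push_cast at h2
  linarith
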